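/- Model. A group of $n$ agents choose simultaneously, in each period $t=1,2,\dots$, between a risky and a safe action. A state $\theta\in\{0,1\}$ is drawn once, before play, and is common to all agents. The safe action pays $0$. The risky action pays $X_l<0$ for sure if $\theta=0$; if $\theta=1$ it pays $X_h>0$ with probability $\pi\in(0,1)$ and $X_l$ otherwise, independently across agents and periods given $\theta$. Write $E_1=\pi X_h+(1-\pi)X_l$, assumed positive, and $E_0=-X_l>0$ for the expected loss from the risky action when $\theta=0$. Actions are publicly observed and payoffs are private. Agents maximize expected discounted payoffs with common discount factor $\delta\in(0,1)$, and agent $i$ has the commonly known prior probability $q_i\in(0,1)$ that $\theta=1$. A weak perfect Bayesian equilibrium is a profile of (behaviour) strategies together with a system of beliefs on information sets, such that beliefs follow Bayes' rule at every information set reached with positive probability and every agent's strategy is optimal at each of her information sets given these beliefs. A cascade equilibrium is a weak perfect Bayesian equilibrium for which there are finite cutoffs $\tau_i\ge 1$ such that on the equilibrium path: (1) agent $i$ plays risky in all periods $t<\tau_i$; (2) if every agent $j$ with $\tau_j<\tau_i$ played safe at $t=\tau_j$, then at $t=\tau_i$ agent $i$ switches to the safe action if and only if each of her risky draws so far was $X_l$,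 and having switched she keeps to the safe action as long as no agent fails to switch at her own cutoff; (3) if some agent $j$ does not switch at $t=\tau_j$, then all agents play risky in every period from $t=\tau_j+1$ on. Proposition 1. Suppose that the prior is common, that is, $q_i=q_j$ for all $i,j$, that $\delta+\pi-(1-\pi)\bigl(1+\frac{\delta\pi}{1-\delta}\bigr)\neq 0$, and that $$\frac{E_1}{E_0}\ \ge\ \frac{1-\pi}{\delta+\pi-(1-\pi)\bigl(1+\frac{\delta\pi}{1-\delta}\bigr)}.$$ Then a cascade equilibrium exists. -/

import Mathlib

/-! Strategic experimentation with observable actions and private payoffs: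
two actions (risky, safe), a common unknown state, infinitely many periods `t = 1, 2, …`. -/

namespace Cascade

/-- The two actions. -/
inductive Act where
  | risky
  | safe
  deriving DecidableEq

/-- What happens to one agent in one period: she plays safe (payoff `0`), or she plays risky and
draws the low payoff, or she plays risky and draws the high payoff. -/
inductive Outcome where
  | safe
  | low
  | high
  deriving DecidableEq

instance : Fintype Outcome where
  elems := {.safe, .low, .high}
  complete := by intro x; cases x <;> decide

/-- The action behind an outcome. -/
def Outcome.act : Outcome → Act
  | .safe => .safe
  | .low => .risky
  | .high => .risky

/-- A full history (all actions and all draws), with the most recent period first.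
A history of length `m` is the state of affairs at the start of period `m + 1`. -/
abbrev Hist (n : ℕ) := List (Fin n → Outcome)

/-- What an agent has seen: for every past period, the actions of all agents and her own outcome;
the most recent period first. -/
abbrev Info (n : ℕ) := List ((Fin n → Act) × Outcome)

/-- What agent `i` has seen at history `h`. -/
def view {n : ℕ} (i : Fin n) (h : Hist n) : Info n :=
  h.map fun o => (fun j => (o j).act, o i)

/-- A behaviour strategy: the probability of the risky action, as a function of what the
agent has seen. -/
abbrev Strategy (n : ℕ) := Info n → unitInterval

/-- A strategy profile. -/
abbrev Profile (n : ℕ) := Fin n → Strategy n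

/-- A decision node: the state of the world (`true` is the good state `θ = 1`) and a history. -/
abbrev Node (n : ℕ) := Bool × Hist n

/-- A system of beliefs: a weight on nodes for each agent and each thing she may have seen. -/
abbrev Beliefs (n : ℕ) := Fin n → Info n → Node n → ℝ

/-- The finite set of all histories of length `m`. -/
def histories (n : ℕ) : ℕ → Finset (Hist n)
  | 0 => {[]}
  | m + 1 => (Finset.univ ×ˢ histories n m).image fun p => p.1 :: p.2

theorem mem_histories {n : ℕ} (m : ℕ) (h : Hist n) : h ∈ histories n m ↔ h.length = m := by
  induction m generalizing h with
  | zero => simp [histories]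
  | succ m ih => cases h with
    | nil => simp [histories]
    | cons o h => simp [histories, ih]

/-- A node belongs to the game tree unless it has a high draw in the bad state. -/
def Feasible {n : ℕ} (x : Node n) : Prop :=
  x.1 = false → ∀ o ∈ x.2, ∀ j, o j ≠ Outcome.high

open Classical in
/-- The information set of agent `i` when she has seen `I`: all nodes of the game tree at which
this is what she has seen. -/
noncomputable def infoSet {n : ℕ} (i : Fin n) (I : Info n) : Finset (Node n) :=
  (Finset.univ ×ˢ histories n I.length).filter fun x => Feasible x ∧ view i x.2 = I

theorem mem_infoSet {n : ℕ} (i : Fin n) (I : Info n) (x : Node n) :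
    x ∈ infoSet i I ↔ Feasible x ∧ view i x.2 = I := by
  simp only [infoSet, Finset.mem_filter, Finset.mem_product, Finset.mem_univ, true_and,
    mem_histories, and_iff_right_iff_imp]
  rintro ⟨-, rfl⟩
  simp [view]

/-- The data of the model with `n` agents. -/
structure Game (n : ℕ) where
  /-- the discount factor -/
  δ : ℝ
  /-- the probability of the high payoff in the good state -/
  π : ℝ
  /-- the high payoff of the risky action -/
  Xh : ℝ
  /-- the low payoff of the risky action -/
  Xl : ℝ
  /-- the prior probability that each agent puts on the good state -/
  q : Fin n → ℝ
  δ_pos : 0 < δ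
  δ_lt_one : δ < 1
  π_pos : 0 < π
  π_lt_one : π < 1
  Xh_pos : 0 < Xh
  Xl_neg : Xl < 0
  /-- the risky action has a positive mean in the good state -/
  mean_pos : 0 < π * Xh + (1 - π) * Xl
  q_pos : ∀ i, 0 < q i
  q_lt_one : ∀ i, q i < 1

namespace Game

variable {n : ℕ} (G : Game n)

/-- The expected payoff of the risky action in the good state. -/
def E₁ : ℝ := G.π * G.Xh + (1 - G.π) * G.Xl

/-- The expected loss from the risky action in the bad state (a positive number). -/
def E₀ : ℝ := -G.Xl

/-- The probability of the high payoff of the risky action in state `θ`. -/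
def winProb (θ : Bool) : ℝ := if θ then G.π else 0

/-- The prior probability that agent `i` puts on state `θ`. -/
def prior (i : Fin n) (θ : Bool) : ℝ := if θ then G.q i else 1 - G.q i

/-- The payoff of an agent in one period. -/
def pay : Outcome → ℝ
  | .safe => 0
  | .low => G.Xl
  | .high => G.Xh

/-- The probability of an outcome for an agent who plays risky with probability `ρ` in
state `θ`. -/
def outcomeProb (θ : Bool) (ρ : ℝ) : Outcome → ℝ
  | .safe => 1 - ρ
  | .low => ρ * (1 - G.winProb θ)
  | .high => ρ * G.winProb θ

/-- The probability that the next period brings the outcomes `o`, from history `h` in state `θ`.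
Agents move simultaneously, and draws are independent across agents given the state. -/
noncomputable def stepProb (σ : Profile n) (θ : Bool) (h : Hist n) (o : Fin n → Outcome) : ℝ :=
  ∏ j, G.outcomeProb θ (σ j (view j h)) (o j)

/-- The probability of history `h` in state `θ`. -/
noncomputable def histProb (σ : Profile n) (θ : Bool) : Hist n → ℝ
  | [] => 1
  | o :: h => histProb σ θ h * G.stepProb σ θ h o

/-- The probability of a node for agent `i`, who uses her own prior. -/
noncomputable def nodeProb (σ : Profile n) (i : Fin n) (x : Node n) : ℝ :=
  G.prior i x.1 * G.histProb σ x.1 x.2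

/-- The expected payoff of agent `i` in the period that comes `k` periods after the current one,
at history `h` in state `θ`. -/
noncomputable def expPay (σ : Profile n) (i : Fin n) (θ : Bool) : ℕ → Hist n → ℝ
  | 0, h => ∑ o : Fin n → Outcome, G.stepProb σ θ h o * G.pay (o i)
  | k + 1, h => ∑ o : Fin n → Outcome, G.stepProb σ θ h o * expPay σ i θ k (o :: h)

/-- The expected discounted continuation payoff of agent `i` at a node. -/
noncomputable def contPayoff (σ : Profile n) (i : Fin n) (x : Node n) : ℝ :=
  (1 - G.δ) * ∑' k : ℕ, G.δ ^ k * G.expPay σ i x.1 k x.2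

/-- The probability, for agent `i`, that her information set `I` is reached. -/
noncomputable def reachProb (σ : Profile n) (i : Fin n) (I : Info n) : ℝ :=
  ∑ x ∈ infoSet i I, G.nodeProb σ i x

/-- The expected continuation payoff of agent `i` at her information set `I` with beliefs `μ`. -/
noncomputable def infoPayoff (σ : Profile n) (μ : Beliefs n) (i : Fin n) (I : Info n) : ℝ :=
  ∑ x ∈ infoSet i I, μ i I x * G.contPayoff σ i x

/-- `μ` is a probability distribution on every information set. -/
def IsBeliefSystem (μ : Beliefs n) : Prop :=
  ∀ i I, (infoSet i I).Nonempty →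
    (∀ x ∈ infoSet i I, 0 ≤ μ i I x) ∧ ∑ x ∈ infoSet i I, μ i I x = 1

/-- Bayes' rule at every information set that is reached with positive probability. -/
def BayesConsistent (σ : Profile n) (μ : Beliefs n) : Prop :=
  ∀ i I, 0 < G.reachProb σ i I →
    ∀ x ∈ infoSet i I, μ i I x = G.nodeProb σ i x / G.reachProb σ i I

/-- At every information set, on or off the path, no change of the own strategy is profitable. -/
def SequentiallyRational (σ : Profile n) (μ : Beliefs n) : Prop :=
  ∀ i I, (infoSet i I).Nonempty → ∀ s : Strategy n,
    G.infoPayoff (Function.update σ i s) μ i I ≤ G.infoPayoff σ μ i I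

/-- Weak perfect Bayesian equilibrium. -/
def IsWeakPBE (σ : Profile n) (μ : Beliefs n) : Prop :=
  IsBeliefSystem μ ∧ G.BayesConsistent σ μ ∧ G.SequentiallyRational σ μ

/-- A history on the path of play. Priors are interior, so all agents agree on these. -/
def OnPath (σ : Profile n) (h : Hist n) : Prop :=
  ∃ θ, 0 < G.histProb σ θ h

/-- At some past period `τ j` in `h`, agent `j` played risky, that is, she did not switch at her
cutoff. -/
def MissedCutoff (τ : Fin n → ℕ) (h : Hist n) : Prop :=
  ∃ j o h', (o :: h') <:+ h ∧ h'.length + 1 = τ j ∧ (o j).act = Act.risky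

/-- Every risky draw of agent `i` in `h` was low. -/
def OnlyLow (i : Fin n) (h : Hist n) : Prop :=
  ∀ o ∈ h, (o i).act = Act.risky → o i = Outcome.low

/-- Agent `i` plays risky for sure at `h`. -/
def PlaysRisky (σ : Profile n) (i : Fin n) (h : Hist n) : Prop := σ i (view i h) = 1

/-- Agent `i` plays safe for sure at `h`. -/
def PlaysSafe (σ : Profile n) (i : Fin n) (h : Hist n) : Prop := σ i (view i h) = 0

/-- The cascade outcome with cutoffs `τ`. On the path, in the period `t = h.length + 1`:
* as long as nobody has missed a cutoff, agent `i` plays risky when `t < τ i`; at `t = τ i` she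
  plays safe if all her draws were low and risky otherwise; and when `t > τ i` she, having
  switched, keeps to the safe action;
* as soon as some agent has missed her cutoff, everybody plays risky. -/
def InducesCascade (σ : Profile n) (τ : Fin n → ℕ) : Prop :=
  (∀ i, 1 ≤ τ i) ∧
  ∀ h, G.OnPath σ h →
    (¬ MissedCutoff τ h → ∀ i,
      (h.length + 1 < τ i → PlaysRisky σ i h) ∧
      (h.length + 1 = τ i → OnlyLow i h → PlaysSafe σ i h) ∧
      (h.length + 1 = τ i → ¬ OnlyLow i h → PlaysRisky σ i h) ∧
      (τ i < h.length + 1 → PlaysSafe σ i h)) ∧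
    (MissedCutoff τ h → ∀ i, PlaysRisky σ i h)

/-- A cascade equilibrium: a weak perfect Bayesian equilibrium with a cascade outcome. -/
def IsCascadeEquilibrium (σ : Profile n) : Prop :=
  (∃ μ, G.IsWeakPBE σ μ) ∧ ∃ τ, G.InducesCascade σ τ

theorem sum_stepProb (σ : Profile n) (θ : Bool) (h : Hist n) :
    ∑ o : Fin n → Outcome, G.stepProb σ θ h o = 1 := by
  have e : (Finset.univ : Finset Outcome) = {.safe, .low, .high} := rfl
  have key : ∀ j, ∑ x : Outcome, G.outcomeProb θ (σ j (view j h)) x = 1 := by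
    intro j
    rw [e]
    simp [outcomeProb]
    ring
  simp only [stepProb]
  rw [← Fintype.prod_sum]
  simp [key]

theorem stepProb_nonneg (σ : Profile n) (θ : Bool) (h : Hist n) (o : Fin n → Outcome) :
    0 ≤ G.stepProb σ θ h o := by
  refine Finset.prod_nonneg fun j _ => ?_
  have h0 := (σ j (view j h)).2.1
  have h1 := (σ j (view j h)).2.2
  have p0 := G.π_pos
  have p1 := G.π_lt_one
  have w0 : 0 ≤ G.winProb θ := by unfold winProb; split_ifs <;> linarith
  have w1 : G.winProb θ ≤ 1 := by unfold winProb; split_ifs <;> linarith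
  cases o j <;> simp only [outcomeProb]
  · linarith
  · exact mul_nonneg h0 (by linarith)
  · exact mul_nonneg h0 w0

theorem abs_expPay_le (σ : Profile n) (i : Fin n) (θ : Bool) (k : ℕ) (h : Hist n) :
    |G.expPay σ i θ k h| ≤ G.Xh - G.Xl := by
  have a := G.Xh_pos
  have b := G.Xl_neg
  have avg : ∀ (h : Hist n) (f : (Fin n → Outcome) → ℝ), (∀ o, |f o| ≤ G.Xh - G.Xl) →
      |∑ o : Fin n → Outcome, G.stepProb σ θ h o * f o| ≤ G.Xh - G.Xl := by
    intro h f hf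
    calc |∑ o : Fin n → Outcome, G.stepProb σ θ h o * f o|
        ≤ ∑ o : Fin n → Outcome, |G.stepProb σ θ h o * f o| := Finset.abs_sum_le_sum_abs _ _
      _ ≤ ∑ o : Fin n → Outcome, G.stepProb σ θ h o * (G.Xh - G.Xl) := by
          refine Finset.sum_le_sum fun o _ => ?_
          rw [abs_mul, abs_of_nonneg (G.stepProb_nonneg σ θ h o)]
          exact mul_le_mul_of_nonneg_left (hf o) (G.stepProb_nonneg σ θ h o)
      _ = G.Xh - G.Xl := by rw [← Finset.sum_mul, sum_stepProb, one_mul]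
  induction k generalizing h with
  | zero =>
    refine avg h _ fun o => ?_
    cases o i <;> simp only [pay] <;> rw [abs_le] <;> constructor <;> linarith
  | succ k ih => exact avg h _ fun o => ih _

/-- The series in the continuation payoff always converges. -/
theorem summable_expPay (σ : Profile n) (i : Fin n) (θ : Bool) (h : Hist n) :
    Summable fun k : ℕ => G.δ ^ k * G.expPay σ i θ k h := by
  refine Summable.of_norm_bounded (g := fun k => G.δ ^ k * (G.Xh - G.Xl))
    ((summable_geometric_of_lt_one G.δ_pos.le G.δ_lt_one).mul_right _) fun k => ?_
  rw [Real.norm_eq_abs, abs_mul, abs_of_nonneg (pow_nonneg G.δ_pos.le k)]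
  exact mul_le_mul_of_nonneg_left (G.abs_expPay_le σ i θ k h) (pow_nonneg G.δ_pos.le k)

end Game

end Cascade

namespace Cascade

/-! Let `K` be the least number of low draws after which the one-period gain `slack` of a lone agent
is no longer positive. Everyone experiments for `K` periods and stops at the common cutoff `K + 1`
if her record is quiet, that is, equal to `quietInfo`. Any departure from that record, a high draw
of her own or an unexpected action of someone, is answered by risky play forever.

At an information set off the quiet path the bad state has probability zero. If the set is reached,
this is because play in the bad state follows `quietHist` for sure (`eq_quietHist`); if not, beliefs
are chosen so. Risky play forever then earns `E₁`, the most possible in the good state.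

Before the cutoff, a deviation to safe is public and makes all others play risky whatever they draw,
so they teach nothing more. The deviator is left with the problem of a lone agent
(`truncPay_le_of_silent`). Conforming is worth at least as much: it runs the same experiments and
can only gain from news at the cutoff (`loneValue_le_contPayoff`, `truncPay_le_of_le`).

From the cutoff on, there are two cases (`truncPay_le_of_ge`). If all records are quiet, everybody
stops, and one more experiment gains only a lone agent's slack. If another agent's record is not
quiet, the state is good; stopping brings the news one period later, and experimenting now gains at
most `(1 - δ) E₁`. Weighted together, the two gains are bounded by the slack at the agent's own
weights, which is nonpositive by the choice of `K`.

Beliefs enter as unnormalised positive functionals on nodes, so conditioning is composition with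
`branch` and needs no division. Deviations are bounded on finite horizons, then in the limit. -/

/-- The outcome of every agent in period `m + 1` when all draws are low and the common cutoff
is `K + 1`. -/
def quietOutcome (K m : ℕ) : Outcome := if m < K then .low else .safe

/-- The history in which everybody draws low payoffs for `K` periods and plays safe afterwards. -/
def quietHist (n K : ℕ) : ℕ → Hist n
  | 0 => []
  | m + 1 => (fun _ => quietOutcome K m) :: quietHist n K m

/-- What every agent sees along `quietHist`. -/
def quietInfo (n K : ℕ) : ℕ → Info n
  | 0 => []
  | m + 1 => (fun _ => (quietOutcome K m).act, quietOutcome K m) :: quietInfo n K m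

/-- Agents play safe exactly along `quietInfo`, from period `K + 1` on. -/
def cascadeProfile (n K : ℕ) : Profile n :=
  fun _ I => if K ≤ I.length ∧ I = quietInfo n K I.length then 0 else 1

/-! ### Quiet records and the actions prescribed on and off them. -/

section Quiet

variable {n : ℕ} {K : ℕ}

@[simp] theorem length_view (i : Fin n) (h : Hist n) : (view i h).length = h.length := by
  simp [view]

@[simp] theorem length_quietInfo (m : ℕ) : (quietInfo n K m).length = m := by
  induction m with
  | zero => rfl
  | succ m ih => simp [quietInfo, ih]

@[simp] theorem length_quietHist (m : ℕ) : (quietHist n K m).length = m := by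
  induction m with
  | zero => rfl
  | succ m ih => simp [quietHist, ih]

theorem view_quietHist (i : Fin n) (m : ℕ) : view i (quietHist n K m) = quietInfo n K m := by
  induction m with
  | zero => rfl
  | succ m ih => simp [quietHist, quietInfo, ← ih, view]

theorem view_cons (i : Fin n) (o : Fin n → Outcome) (h : Hist n) :
    view i (o :: h) = (fun j => (o j).act, o i) :: view i h := rfl

theorem view_cons_eq_quietInfo {i : Fin n} {o : Fin n → Outcome} {h : Hist n} {m : ℕ} :
    view i (o :: h) = quietInfo n K (m + 1) ↔
      ((∀ j, (o j).act = (quietOutcome K m).act) ∧ o i = quietOutcome K m) ∧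
        view i h = quietInfo n K m := by
  simp [view_cons, quietInfo, funext_iff]

/-- Records are never erased, so leaving the quiet path is irreversible. -/
theorem view_cons_ne {i : Fin n} {h : Hist n} (H : view i h ≠ quietInfo n K h.length)
    (o : Fin n → Outcome) : view i (o :: h) ≠ quietInfo n K (o :: h).length := by
  intro e
  exact H (view_cons_eq_quietInfo.1 e).2

theorem cascadeProfile_of_lt (j : Fin n) {h : Hist n} (H : h.length < K) :
    cascadeProfile n K j (view j h) = 1 := by
  rw [cascadeProfile, if_neg]
  rw [length_view]
  omega

theorem cascadeProfile_of_ne {j : Fin n} {h : Hist n} (H : view j h ≠ quietInfo n K h.length) :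
    cascadeProfile n K j (view j h) = 1 := by
  rw [cascadeProfile, if_neg]
  rw [length_view]
  exact fun e => H e.2

theorem cascadeProfile_of_eq {j : Fin n} {h : Hist n} (hK : K ≤ h.length)
    (H : view j h = quietInfo n K h.length) :
    cascadeProfile n K j (view j h) = 0 := by
  rw [cascadeProfile, if_pos]
  rw [length_view]
  exact ⟨hK, H⟩

end Quiet

/-! ### One-period probabilities and expectations. -/

namespace Game

variable {n : ℕ} (G : Game n)

theorem winProb_nonneg (θ : Bool) : 0 ≤ G.winProb θ := by
  have := G.π_pos
  unfold winProb; split_ifs <;> linarith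

theorem winProb_lt_one (θ : Bool) : G.winProb θ < 1 := by
  have := G.π_lt_one
  unfold winProb; split_ifs <;> linarith

theorem outcomeProb_nonneg (θ : Bool) (ρ : unitInterval) (y : Outcome) :
    0 ≤ G.outcomeProb θ ρ y := by
  have h0 := ρ.2.1
  have h1 := ρ.2.2
  have w0 := G.winProb_nonneg θ
  have w1 := G.winProb_lt_one θ
  cases y <;> simp only [outcomeProb]
  · linarith
  · exact mul_nonneg h0 (by linarith)
  · exact mul_nonneg h0 w0

theorem sum_outcome (f : Outcome → ℝ) : ∑ y, f y = f .safe + f .low + f .high := by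
  have e : (Finset.univ : Finset Outcome) = {.safe, .low, .high} := rfl
  rw [e]
  simp [add_assoc]

/-- The mean payoff of the risky action in state `θ`. -/
def mean (θ : Bool) : ℝ := if θ then G.E₁ else -G.E₀

theorem E₁_pos : 0 < G.E₁ := G.mean_pos

theorem E₀_pos : 0 < G.E₀ := neg_pos.2 G.Xl_neg

/-- Own outcomes have the marginal distribution `outcomeProb`. -/
theorem sum_stepProb_own (σ : Profile n) (i : Fin n) (θ : Bool) (h : Hist n) (g : Outcome → ℝ) :
    ∑ o : Fin n → Outcome, G.stepProb σ θ h o * g (o i) =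
      ∑ y, G.outcomeProb θ (σ i (view i h)) y * g y := by
  -- The test function is placed in the factor of agent `i` and 1 in all others; the sum over
  -- profiles then factorises.
  have key : ∀ j, ∑ y, G.outcomeProb θ (σ j (view j h)) y * (if j = i then g y else 1) =
      if j = i then ∑ y, G.outcomeProb θ (σ i (view i h)) y * g y else 1 := by
    intro j
    split_ifs with e
    · subst e; rfl
    · simp [sum_outcome, outcomeProb]; ring
  have h1 := Fintype.prod_sum
    fun j y => G.outcomeProb θ (σ j (view j h)) y * (if j = i then g y else 1)
  simp only [key, Finset.prod_ite_eq', Finset.mem_univ, if_true] at h1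
  rw [h1]
  refine Finset.sum_congr rfl fun o _ => ?_
  rw [Finset.prod_mul_distrib, stepProb]
  simp

theorem sum_stepProb_pay (σ : Profile n) (i : Fin n) (θ : Bool) (h : Hist n) :
    ∑ o : Fin n → Outcome, G.stepProb σ θ h o * G.pay (o i) = σ i (view i h) * G.mean θ := by
  rw [sum_stepProb_own, sum_outcome]
  simp only [outcomeProb, pay, mean, winProb, E₁, E₀]
  split_ifs <;> ring

theorem outcomeProb_pos_of_stepProb_pos {σ : Profile n} {θ : Bool} {h : Hist n}
    {o : Fin n → Outcome} (H : 0 < G.stepProb σ θ h o) (j : Fin n) :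
    0 < G.outcomeProb θ (σ j (view j h)) (o j) := by
  refine lt_of_le_of_ne (G.outcomeProb_nonneg _ _ _) fun e => H.ne' ?_
  exact Finset.prod_eq_zero (Finset.mem_univ j) e.symm

theorem act_eq_risky {σ : Profile n} {θ : Bool} {h : Hist n}
    {o : Fin n → Outcome} (H : 0 < G.stepProb σ θ h o) {j : Fin n} (hj : σ j (view j h) = 1) :
    (o j).act = .risky := by
  have := G.outcomeProb_pos_of_stepProb_pos H j
  rw [hj] at this
  cases e : o j <;> simp [e, outcomeProb, Outcome.act] at this ⊢

theorem eq_safe {σ : Profile n} {θ : Bool} {h : Hist n}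
    {o : Fin n → Outcome} (H : 0 < G.stepProb σ θ h o) {j : Fin n} (hj : σ j (view j h) = 0) :
    o j = .safe := by
  have := G.outcomeProb_pos_of_stepProb_pos H j
  rw [hj] at this
  cases e : o j <;> simp [e, outcomeProb] at this ⊢

theorem ne_high {σ : Profile n} {h : Hist n}
    {o : Fin n → Outcome} (H : 0 < G.stepProb σ false h o) (j : Fin n) : o j ≠ .high := by
  have := G.outcomeProb_pos_of_stepProb_pos H j
  intro e
  simp [e, outcomeProb, winProb] at this

theorem eq_low_of_act {y : Outcome} (h : y.act = .risky) (h' : y ≠ .high) : y = .low := by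
  cases y <;> simp [Outcome.act] at h h' ⊢

theorem eq_safe_of_act {y : Outcome} (h : y.act = .safe) : y = .safe := by
  cases y <;> simp [Outcome.act] at h ⊢

theorem histProb_nonneg (σ : Profile n) (θ : Bool) (h : Hist n) : 0 ≤ G.histProb σ θ h := by
  induction h with
  | nil => simp [histProb]
  | cons o h ih => exact mul_nonneg ih (G.stepProb_nonneg _ _ _ _)

theorem pos_of_histProb_cons {σ : Profile n} {θ : Bool} {h : Hist n} {o : Fin n → Outcome}
    (H : 0 < G.histProb σ θ (o :: h)) : 0 < G.histProb σ θ h ∧ 0 < G.stepProb σ θ h o := by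
  have a := G.histProb_nonneg σ θ h
  have b := G.stepProb_nonneg σ θ h o
  constructor
  · refine lt_of_le_of_ne a fun e => ?_
    rw [histProb, ← e, zero_mul] at H
    exact H.false
  · refine lt_of_le_of_ne b fun e => ?_
    rw [histProb, ← e, mul_zero] at H
    exact H.false

theorem sum_stepProb_le {σ : Profile n} {θ : Bool} {h : Hist n} {f g : (Fin n → Outcome) → ℝ}
    (H : ∀ o, 0 < G.stepProb σ θ h o → f o ≤ g o) :
    ∑ o, G.stepProb σ θ h o * f o ≤ ∑ o, G.stepProb σ θ h o * g o := by
  refine Finset.sum_le_sum fun o _ => ?_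
  rcases (G.stepProb_nonneg σ θ h o).eq_or_lt with e | e
  · simp [← e]
  · exact mul_le_mul_of_nonneg_left (H o e) e.le

theorem sum_stepProb_congr {σ : Profile n} {θ : Bool} {h : Hist n} {f g : (Fin n → Outcome) → ℝ}
    (H : ∀ o, 0 < G.stepProb σ θ h o → f o = g o) :
    ∑ o, G.stepProb σ θ h o * f o = ∑ o, G.stepProb σ θ h o * g o :=
  le_antisymm (G.sum_stepProb_le fun o ho => (H o ho).le)
    (G.sum_stepProb_le fun o ho => (H o ho).ge)

/-! ### Truncated payoffs -/

/-- The expected discounted payoff of the next `N` periods. -/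
noncomputable def truncPay (σ : Profile n) (i : Fin n) : ℕ → Node n → ℝ
  | 0, _ => 0
  | N + 1, x => ∑ o : Fin n → Outcome, G.stepProb σ x.1 x.2 o *
      ((1 - G.δ) * G.pay (o i) + G.δ * truncPay σ i N (x.1, o :: x.2))

theorem truncPay_eq (σ : Profile n) (i : Fin n) (N : ℕ) (x : Node n) :
    G.truncPay σ i N x =
      (1 - G.δ) * ∑ k ∈ Finset.range N, G.δ ^ k * G.expPay σ i x.1 k x.2 := by
  induction N generalizing x with
  | zero => simp [truncPay]
  | succ N ih =>
    simp only [truncPay, ih, Finset.sum_range_succ', expPay, pow_zero, one_mul, mul_add,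
      Finset.sum_add_distrib]
    rw [add_comm]
    congr 1
    · simp only [Finset.mul_sum]
      rw [Finset.sum_comm]
      refine Finset.sum_congr rfl fun k _ => Finset.sum_congr rfl fun o _ => ?_
      ring
    · rw [Finset.mul_sum]
      refine Finset.sum_congr rfl fun o _ => ?_
      ring

theorem tendsto_truncPay (σ : Profile n) (i : Fin n) (x : Node n) :
    Filter.Tendsto (fun N => G.truncPay σ i N x) Filter.atTop (nhds (G.contPayoff σ i x)) := by
  simp only [truncPay_eq]
  exact ((G.summable_expPay σ i x.1 x.2).hasSum.tendsto_sum_nat).const_mul _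

theorem contPayoff_eq (σ : Profile n) (i : Fin n) (x : Node n) :
    G.contPayoff σ i x = ∑ o : Fin n → Outcome, G.stepProb σ x.1 x.2 o *
      ((1 - G.δ) * G.pay (o i) + G.δ * G.contPayoff σ i (x.1, o :: x.2)) := by
  -- Both sides are limits of truncated payoffs, the left one with its horizon shifted by one.
  refine tendsto_nhds_unique ((G.tendsto_truncPay σ i x).comp (Filter.tendsto_add_atTop_nat 1)) ?_
  refine tendsto_finsetSum _ fun o _ => ?_
  exact (((G.tendsto_truncPay σ i _).const_mul _).const_add _).const_mul _

theorem sum_stepProb_pay_add (σ : Profile n) (i : Fin n) (θ : Bool) (h : Hist n) (a : ℝ) :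
    ∑ o : Fin n → Outcome, G.stepProb σ θ h o * ((1 - G.δ) * G.pay (o i) + G.δ * a) =
      (1 - G.δ) * (σ i (view i h) * G.mean θ) + G.δ * a := by
  have := G.sum_stepProb_pay σ i θ h
  simp only [mul_add, Finset.sum_add_distrib, mul_left_comm _ (1 - G.δ), ← Finset.mul_sum,
    ← Finset.sum_mul, this, sum_stepProb, one_mul]

theorem truncPay_true_le (σ : Profile n) (i : Fin n) (N : ℕ) (h : Hist n) :
    G.truncPay σ i N (true, h) ≤ G.E₁ := by
  induction N generalizing h with
  | zero => exact G.E₁_pos.le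
  | succ N ih =>
    have hδ := G.δ_pos
    have hδ' := G.δ_lt_one
    have hE := G.E₁_pos
    have hσ := (σ i (view i h)).2.2
    calc G.truncPay σ i (N + 1) (true, h)
        ≤ ∑ o : Fin n → Outcome, G.stepProb σ true h o *
            ((1 - G.δ) * G.pay (o i) + G.δ * G.E₁) :=
          G.sum_stepProb_le fun o _ => by gcongr; exact ih _
      _ = (1 - G.δ) * (σ i (view i h) * G.E₁) + G.δ * G.E₁ := G.sum_stepProb_pay_add σ i true h _
      _ ≤ (1 - G.δ) * (1 * G.E₁) + G.δ * G.E₁ := by gcongr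
      _ = G.E₁ := by ring

/-- Sharper than the bound `E₁`: it retains today's probability of risky, as the comparison at the
cutoff with the conforming payoff `δ E₁` requires. -/
theorem truncPay_true_succ_le (σ : Profile n) (i : Fin n) (N : ℕ) (h : Hist n) :
    G.truncPay σ i (N + 1) (true, h) ≤
      (1 - G.δ) * (σ i (view i h) * G.E₁) + G.δ * G.E₁ := by
  have hδ := G.δ_pos
  refine le_trans ?_ (G.sum_stepProb_pay_add σ i true h G.E₁).le
  exact G.sum_stepProb_le fun o _ => by gcongr; exact G.truncPay_true_le σ i N _

theorem contPayoff_true_le (σ : Profile n) (i : Fin n) (h : Hist n) :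
    G.contPayoff σ i (true, h) ≤ G.E₁ :=
  le_of_tendsto' (G.tendsto_truncPay σ i _) fun N => G.truncPay_true_le σ i N h

theorem contPayoff_of_expPay_const {σ : Profile n} {i : Fin n} {x : Node n} {a : ℝ}
    (H : ∀ k, G.expPay σ i x.1 k x.2 = a) : G.contPayoff σ i x = a := by
  have hδ := G.δ_lt_one
  simp only [contPayoff, H, tsum_mul_right, tsum_geometric_of_lt_one G.δ_pos.le hδ]
  have : 1 - G.δ ≠ 0 := by linarith
  field_simp

/-! ### Branching on the own outcome -/

/-- The probability of the risky action for an agent who plays the action behind `y`. -/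
def intent : Outcome → unitInterval
  | .safe => 0
  | _ => 1

/-- The expectation of `f` after one more period in which agent `i` plays the action behind `y`,
on the event that her outcome is `y`; the others follow `σ`. -/
noncomputable def branch (σ : Profile n) (i : Fin n) (y : Outcome) :
    (Node n → ℝ) →ₗ[ℝ] (Node n → ℝ) where
  toFun f x := ∑ o : Fin n → Outcome,
    G.stepProb (Function.update σ i fun _ => intent y) x.1 x.2 o *
      (if o i = y then f (x.1, o :: x.2) else 0)
  map_add' f g := by
    ext x
    simp only [Pi.add_apply, ← Finset.sum_add_distrib, ← mul_add]
    refine Finset.sum_congr rfl fun o _ => ?_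
    split_ifs <;> ring
  map_smul' c f := by
    ext x
    simp only [Pi.smul_apply, smul_eq_mul, Finset.mul_sum, RingHom.id_apply]
    refine Finset.sum_congr rfl fun o _ => ?_
    split_ifs <;> ring

theorem branch_apply (σ : Profile n) (i : Fin n) (y : Outcome) (f : Node n → ℝ) (x : Node n) :
    G.branch σ i y f x = ∑ o : Fin n → Outcome,
      G.stepProb (Function.update σ i fun _ => intent y) x.1 x.2 o *
        (if o i = y then f (x.1, o :: x.2) else 0) := rfl

theorem branch_state (σ : Profile n) (i : Fin n) (y : Outcome) (φ : Bool → ℝ) (x : Node n) :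
    G.branch σ i y (fun z => φ z.1) x = G.outcomeProb x.1 (intent y) y * φ x.1 := by
  rw [branch_apply, G.sum_stepProb_own _ i x.1 x.2 fun u => if u = y then φ x.1 else 0]
  simp

theorem stepProb_update (σ : Profile n) (i : Fin n) (s : Strategy n) (θ : Bool) (h : Hist n)
    (o : Fin n → Outcome) :
    G.stepProb (Function.update σ i s) θ h o =
      G.outcomeProb θ (s (view i h)) (o i) *
        ∏ j ∈ Finset.univ.erase i, G.outcomeProb θ (σ j (view j h)) (o j) := by
  rw [stepProb, ← Finset.mul_prod_erase _ _ (Finset.mem_univ i), Function.update_self]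
  congr 1
  refine Finset.prod_congr rfl fun j hj => ?_
  rw [Function.update_of_ne (Finset.ne_of_mem_erase hj)]

/-- The value of a period is affine in the agent's own mixing probability. The branches themselves
do not depend on `s`, so each pure action can be bounded separately. -/
theorem sum_stepProb_update (σ : Profile n) (i : Fin n) (s : Strategy n) (x : Node n)
    (f : Node n → ℝ) :
    ∑ o : Fin n → Outcome, G.stepProb (Function.update σ i s) x.1 x.2 o *
        ((1 - G.δ) * G.pay (o i) + G.δ * f (x.1, o :: x.2)) =
      s (view i x.2) * ((1 - G.δ) * G.mean x.1 +
        G.δ * (G.branch σ i .low f x + G.branch σ i .high f x)) +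
      (1 - s (view i x.2)) * (G.δ * G.branch σ i .safe f x) := by
  have e : ∑ o : Fin n → Outcome, G.stepProb (Function.update σ i s) x.1 x.2 o *
        ((1 - G.δ) * G.pay (o i)) = s (view i x.2) * ((1 - G.δ) * G.mean x.1) := by
    have := G.sum_stepProb_pay (Function.update σ i s) i x.1 x.2
    simp only [mul_left_comm _ (1 - G.δ), ← Finset.mul_sum, this, Function.update_self]
  simp only [mul_add, Finset.sum_add_distrib] at e ⊢
  rw [e, add_assoc, add_assoc]
  congr 1
  simp only [branch_apply, stepProb_update, Finset.mul_sum, ← Finset.sum_add_distrib]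
  refine Finset.sum_congr rfl fun o _ => ?_
  cases o i <;> simp [outcomeProb, intent] <;> ring

/-! ### Positive functionals -/

/-- The functional `L`, a weight on nodes, is positive and concentrated on `P`. -/
def Carried (P : Node n → Prop) (L : (Node n → ℝ) →ₗ[ℝ] ℝ) : Prop :=
  ∀ f, (∀ x, P x → 0 ≤ f x) → 0 ≤ L f

/-- The weight that `L` puts on state `θ`. -/
def mass (L : (Node n → ℝ) →ₗ[ℝ] ℝ) (θ : Bool) : ℝ := L fun x => if x.1 = θ then 1 else 0

section Carried

variable {P Q : Node n → Prop} {L : (Node n → ℝ) →ₗ[ℝ] ℝ}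

theorem Carried.le (H : Carried P L) {f g : Node n → ℝ} (h : ∀ x, P x → f x ≤ g x) :
    L f ≤ L g := by
  have := H (g - f) fun x hx => sub_nonneg.2 (h x hx)
  rwa [map_sub, sub_nonneg] at this

theorem Carried.congr (H : Carried P L) {f g : Node n → ℝ} (h : ∀ x, P x → f x = g x) :
    L f = L g :=
  le_antisymm (H.le fun x hx => (h x hx).le) (H.le fun x hx => (h x hx).ge)

theorem Carried.mono (H : Carried P L) (h : ∀ x, P x → Q x) : Carried Q L :=
  fun f hf => H f fun x hx => hf x (h x hx)

theorem Carried.mass_nonneg (H : Carried P L) (θ : Bool) : 0 ≤ mass L θ :=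
  H _ fun x _ => by split_ifs <;> norm_num

/-- A function of the state alone sees only the two masses; this reduces payoff bounds to arithmetic
in two weights. -/
theorem apply_state (L : (Node n → ℝ) →ₗ[ℝ] ℝ) (φ : Bool → ℝ) :
    L (fun x => φ x.1) = φ true * mass L true + φ false * mass L false := by
  have : (fun x : Node n => φ x.1) = φ true • (fun x : Node n => if x.1 = true then (1 : ℝ) else 0)
      + φ false • (fun x : Node n => if x.1 = false then (1 : ℝ) else 0) := by
    ext ⟨θ, h⟩
    cases θ <;> simp
  rw [this, map_add, map_smul, map_smul]
  rfl

theorem Carried.branch (H : Carried P L) {σ : Profile n} {i : Fin n} {y : Outcome}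
    (h : ∀ x, P x → ∀ o, o i = y →
      0 < G.stepProb (Function.update σ i fun _ => intent y) x.1 x.2 o → Q (x.1, o :: x.2)) :
    Carried Q (L ∘ₗ G.branch σ i y) := by
  intro f hf
  refine H _ fun x hx => ?_
  rw [branch_apply]
  have := G.sum_stepProb_le (σ := Function.update σ i fun _ => intent y) (θ := x.1) (h := x.2)
    (f := fun _ => 0) (g := fun o => if o i = y then f (x.1, o :: x.2) else 0) fun o ho => by
      split_ifs with e
      · exact hf _ (h x hx o e ho)
      · exact le_rfl
  simpa using this

theorem mass_branch (L : (Node n → ℝ) →ₗ[ℝ] ℝ) (σ : Profile n) (i : Fin n) (y : Outcome)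
    (θ : Bool) :
    mass (L ∘ₗ G.branch σ i y) θ = G.outcomeProb θ (intent y) y * mass L θ := by
  have : (G.branch σ i y fun x => if x.1 = θ then 1 else 0) =
      G.outcomeProb θ (intent y) y • fun x : Node n => if x.1 = θ then (1 : ℝ) else 0 := by
    ext x
    rw [G.branch_state σ i y fun b => if b = θ then 1 else 0]
    by_cases e : x.1 = θ
    · simp [e]
    · simp [e]
  rw [mass, LinearMap.comp_apply, this, map_smul, mass, smul_eq_mul]

theorem mass_branch_low (L : (Node n → ℝ) →ₗ[ℝ] ℝ) (σ : Profile n) (i : Fin n) :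
    mass (L ∘ₗ G.branch σ i .low) true = (1 - G.π) * mass L true ∧
      mass (L ∘ₗ G.branch σ i .low) false = mass L false := by
  simp [mass_branch, outcomeProb, intent, winProb]

theorem mass_branch_safe (L : (Node n → ℝ) →ₗ[ℝ] ℝ) (σ : Profile n) (i : Fin n) (θ : Bool) :
    mass (L ∘ₗ G.branch σ i .safe) θ = mass L θ := by
  simp [mass_branch, outcomeProb, intent]

theorem mass_branch_high (L : (Node n → ℝ) →ₗ[ℝ] ℝ) (σ : Profile n) (i : Fin n) :
    mass (L ∘ₗ G.branch σ i .high) true = G.π * mass L true := by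
  simp [mass_branch, outcomeProb, intent, winProb]

theorem Carried.branch_high (H : Carried P L) (σ : Profile n) (i : Fin n) :
    Carried (fun x => x.1 = true) (L ∘ₗ G.branch σ i .high) := by
  refine Carried.branch G H fun x _ o hi ho => ?_
  by_contra e
  rw [Bool.not_eq_true] at e
  rw [e] at ho
  exact G.ne_high ho i hi

/-- A high draw proves the good state, where no continuation is worth more than `E₁`. -/
theorem Carried.branch_high_le (H : Carried P L) (σ : Profile n) (i : Fin n) {f : Node n → ℝ}
    (hf : ∀ h, f (true, h) ≤ G.E₁) : L (G.branch σ i .high f) ≤ G.π * mass L true * G.E₁ := by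
  have h1 : (L ∘ₗ G.branch σ i .high) f ≤ (L ∘ₗ G.branch σ i .high)
      (fun x => (fun θ => if θ = true then G.E₁ else 0) x.1) :=
    (H.branch_high G σ i).le fun ⟨θ, h⟩ hx => by
      obtain rfl : θ = true := hx
      simpa using hf h
  rw [apply_state _ fun θ => if θ = true then G.E₁ else 0, mass_branch_high] at h1
  simp only [LinearMap.comp_apply] at h1
  simp at h1
  linarith

/-- The effect of one period on a weight whose nodes look the same to agent `i`. -/
theorem Carried.apply_step (H : Carried P L) {σ : Profile n} {i : Fin n} {s : Strategy n}
    {I : Info n} (hI : ∀ x, P x → view i x.2 = I) (f : Node n → ℝ) :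
    L (fun x => ∑ o : Fin n → Outcome, G.stepProb (Function.update σ i s) x.1 x.2 o *
        ((1 - G.δ) * G.pay (o i) + G.δ * f (x.1, o :: x.2))) =
      s I * ((1 - G.δ) * (G.E₁ * mass L true - G.E₀ * mass L false) +
        G.δ * (L (G.branch σ i .low f) + L (G.branch σ i .high f))) +
      (1 - s I) * (G.δ * L (G.branch σ i .safe f)) := by
  have e : L (fun x => G.mean x.1) = G.E₁ * mass L true - G.E₀ * mass L false := by
    rw [apply_state]
    simp [mean]
    ring
  rw [← e]
  refine (H.congr (g := (s I : ℝ) • ((1 - G.δ) • (fun x => G.mean x.1) +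
    G.δ • (G.branch σ i .low f + G.branch σ i .high f)) +
    (1 - (s I : ℝ)) • (G.δ • G.branch σ i .safe f)) fun x hx => ?_).trans ?_
  · rw [sum_stepProb_update, hI x hx]
    rfl
  · simp only [map_add, map_smul, smul_eq_mul]

end Carried

/-! ### The stopping problem of a lone agent. -/

/-- For a lone agent with weights `w₁`, `w₀` on the two states, the gain from playing risky once,
and forever after a high draw, over playing safe forever. -/
noncomputable def slack (w₁ w₀ : ℝ) : ℝ :=
  (1 - G.δ) * (w₁ * G.E₁ * (1 + G.δ * G.π / (1 - G.δ)) - w₀ * G.E₀)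

theorem slack_eq (w₁ w₀ : ℝ) :
    G.slack w₁ w₀ = (1 - G.δ) * (G.E₁ * w₁ - G.E₀ * w₀) + G.δ * (G.π * w₁ * G.E₁) := by
  have : 1 - G.δ ≠ 0 := by have := G.δ_lt_one; linarith
  rw [slack]
  field_simp
  ring

theorem slack_mono {w₁ w₁' : ℝ} (h : w₁ ≤ w₁') (w₀ : ℝ) : G.slack w₁ w₀ ≤ G.slack w₁' w₀ := by
  have := G.E₁_pos
  have := G.δ_lt_one
  have := G.δ_pos
  have := G.π_pos
  rw [slack_eq, slack_eq]
  gcongr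

/-- The value, to a lone agent with weights `w₁`, `w₀` on the two states, of experimenting for at
most `N` periods and stopping optimally. -/
noncomputable def loneValue : ℕ → ℝ → ℝ → ℝ
  | 0, _, _ => 0
  | N + 1, w₁, w₀ => max 0 (G.slack w₁ w₀) + G.δ * loneValue N ((1 - G.π) * w₁) w₀

theorem loneValue_nonneg (N : ℕ) (w₁ w₀ : ℝ) : 0 ≤ G.loneValue N w₁ w₀ := by
  induction N generalizing w₁ with
  | zero => exact le_rfl
  | succ N ih => exact add_nonneg (le_max_left _ _) (mul_nonneg G.δ_pos.le (ih _))

/-- Together with discounting, this makes idling for a period unprofitable. -/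
theorem loneValue_le_succ (N : ℕ) (w₁ w₀ : ℝ) :
    G.loneValue N w₁ w₀ ≤ G.loneValue (N + 1) w₁ w₀ := by
  induction N generalizing w₁ with
  | zero => exact G.loneValue_nonneg _ _ _
  | succ N ih =>
    rw [loneValue, loneValue.eq_2 G w₁ w₀ (N + 1)]
    have := G.δ_pos
    gcongr
    exact ih _

/-- Low draws only shrink the good weight, so once the slack is nonpositive it stays so. -/
theorem loneValue_eq_zero (N : ℕ) {w₁ w₀ : ℝ} (h₁ : 0 ≤ w₁) (h : G.slack w₁ w₀ ≤ 0) :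
    G.loneValue N w₁ w₀ = 0 := by
  induction N generalizing w₁ with
  | zero => rfl
  | succ N ih =>
    have hπ := G.π_pos
    have hπ' := G.π_lt_one
    have hle : (1 - G.π) * w₁ ≤ w₁ := by nlinarith
    rw [loneValue, max_eq_left h, ih (mul_nonneg (by linarith) h₁)
      ((G.slack_mono hle _).trans h)]
    simp

/-! ### Uninformative play of the others -/

/-- The others' play carries no news for agent `i`: they have left the quiet path and play
risky forever (`b = true`), or they are all on it and past the cutoff (`b = false`). -/
def Silent (K : ℕ) (i : Fin n) (b : Bool) (h : Hist n) : Prop :=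
  ∀ j, j ≠ i → if b then view j h ≠ quietInfo n K h.length
    else K ≤ h.length ∧ view j h = quietInfo n K h.length

theorem Silent.act {K : ℕ} {i : Fin n} {b : Bool} {h : Hist n} (H : Silent K i b h)
    {s : Strategy n} {θ : Bool} {o : Fin n → Outcome}
    (ho : 0 < G.stepProb (Function.update (cascadeProfile n K) i s) θ h o) {j : Fin n}
    (hj : j ≠ i) : (o j).act = if b then .risky else .safe := by
  have hj' := H j hj
  cases b
  · have : o j = .safe := by
      refine G.eq_safe ho ?_
      rw [Function.update_of_ne hj]
      exact cascadeProfile_of_eq hj'.1 hj'.2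
    simp [this, Outcome.act]
  · refine G.act_eq_risky ho ?_
    rw [Function.update_of_ne hj]
    exact cascadeProfile_of_ne hj'

/-- Past the cutoff, a risky action of agent `i` is public and throws all others off the quiet path
at once; this is the only way for `b` to change. -/
theorem Silent.cons {K : ℕ} {i : Fin n} {b : Bool} {h : Hist n} (H : Silent K i b h)
    {s : Strategy n} {θ : Bool} {o : Fin n → Outcome}
    (ho : 0 < G.stepProb (Function.update (cascadeProfile n K) i s) θ h o) :
    Silent K i (b || decide (o i ≠ .safe)) (o :: h) := by
  intro j hj
  have hj' := H j hj
  cases b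
  · simp only [Bool.false_eq_true, if_false] at hj'
    have hq : quietOutcome K h.length = .safe := by
      simp only [quietOutcome, if_neg (not_lt.2 hj'.1)]
    by_cases e : o i = .safe
    · simp only [e, ne_eq, not_true_eq_false, decide_false, Bool.or_self, Bool.false_eq_true,
        if_false, List.length_cons]
      refine ⟨by omega, view_cons_eq_quietInfo.2 ⟨⟨fun k => ?_, ?_⟩, hj'.2⟩⟩
      · rw [hq]
        by_cases hk : k = i
        · rw [hk, e]
        · simpa [Outcome.act] using H.act G ho hk
      · rw [hq]
        exact eq_safe_of_act (by simpa using H.act G ho hj)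
    · simp only [e, ne_eq, not_false_eq_true, decide_true, Bool.or_true, if_true,
        List.length_cons]
      intro he
      have := (view_cons_eq_quietInfo.1 he).1.1 i
      rw [hq] at this
      exact e (eq_safe_of_act this)
  · simpa using view_cons_ne (by simpa using hj') o

variable {L : (Node n → ℝ) →ₗ[ℝ] ℝ} {K : ℕ} {i : Fin n}

/-- The others' actions are forced, so after her own outcome the weight again sits on a single
information set of agent `i`. This is what lets the induction on the horizon continue. -/
theorem Carried.silent_branch {b : Bool} {I : Info n}
    (H : Carried (fun x => view i x.2 = I ∧ Silent K i b x.2) L) (y : Outcome) :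
    Carried (fun x => view i x.2 =
      ((fun j => if j = i then y.act else if b then .risky else .safe), y) :: I ∧
        Silent K i (b || decide (y ≠ .safe)) x.2)
      (L ∘ₗ G.branch (cascadeProfile n K) i y) := by
  refine Carried.branch G H fun x hx o hi ho => ⟨?_, ?_⟩
  · rw [view_cons, hx.1, hi]
    congr 2
    ext j
    by_cases e : j = i
    · rw [if_pos e, e, hi]
    · rw [if_neg e, hx.2.act G ho e]
  · have := hx.2.cons G ho
    rwa [hi] at this

theorem truncPay_succ_le_of_silent {N : ℕ} {s : Strategy n}
    (ih : ∀ (L : (Node n → ℝ) →ₗ[ℝ] ℝ) (b : Bool) (I : Info n),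
      Carried (fun x => view i x.2 = I ∧ Silent K i b x.2) L →
        L (G.truncPay (Function.update (cascadeProfile n K) i s) i N) ≤
          G.loneValue N (mass L true) (mass L false))
    {b : Bool} {I : Info n} (H : Carried (fun x => view i x.2 = I ∧ Silent K i b x.2) L) :
    L (G.truncPay (Function.update (cascadeProfile n K) i s) i (N + 1)) ≤
      s I * (G.slack (mass L true) (mass L false) +
        G.δ * G.loneValue N ((1 - G.π) * mass L true) (mass L false)) +
      (1 - s I) * (G.δ * G.loneValue N (mass L true) (mass L false)) := by
  have hlow := ih _ _ _ (H.silent_branch G .low)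
  have hsafe := ih _ _ _ (H.silent_branch G .safe)
  have hhigh := H.branch_high_le G (cascadeProfile n K) i
    (G.truncPay_true_le (Function.update (cascadeProfile n K) i s) i N)
  rw [(G.mass_branch_low _ _ _).1, (G.mass_branch_low _ _ _).2] at hlow
  rw [mass_branch_safe, mass_branch_safe] at hsafe
  have h0 := (s I).2.1
  have h1 := sub_nonneg.2 (s I).2.2
  have hδ := G.δ_pos
  have e := H.apply_step G (s := s) (σ := cascadeProfile n K) (fun x hx => hx.1)
    (G.truncPay (Function.update (cascadeProfile n K) i s) i N)
  refine (le_of_eq e).trans ?_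
  rw [slack_eq]
  simp only [LinearMap.comp_apply] at hlow hsafe
  have h2 : (s I : ℝ) * ((1 - G.δ) * (G.E₁ * mass L true - G.E₀ * mass L false) +
        G.δ * (L (G.branch (cascadeProfile n K) i .low
          (G.truncPay (Function.update (cascadeProfile n K) i s) i N)) +
          L (G.branch (cascadeProfile n K) i .high
          (G.truncPay (Function.update (cascadeProfile n K) i s) i N)))) ≤
      s I * ((1 - G.δ) * (G.E₁ * mass L true - G.E₀ * mass L false) +
        G.δ * (G.loneValue N ((1 - G.π) * mass L true) (mass L false) +
          G.π * mass L true * G.E₁)) := by gcongr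
  have h3 : (1 - (s I : ℝ)) * (G.δ * L (G.branch (cascadeProfile n K) i .safe
        (G.truncPay (Function.update (cascadeProfile n K) i s) i N))) ≤
      (1 - s I) * (G.δ * G.loneValue N (mass L true) (mass L false)) := by gcongr
  linarith

/-- Against uninformative play of the others, no strategy beats the lone agent's value. -/
theorem truncPay_le_of_silent (N : ℕ) (s : Strategy n)
    (L : (Node n → ℝ) →ₗ[ℝ] ℝ) (b : Bool) (I : Info n)
    (H : Carried (fun x => view i x.2 = I ∧ Silent K i b x.2) L) :
    L (G.truncPay (Function.update (cascadeProfile n K) i s) i N) ≤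
      G.loneValue N (mass L true) (mass L false) := by
  induction N generalizing L b I with
  | zero =>
    have : G.truncPay (Function.update (cascadeProfile n K) i s) i 0 = 0 := rfl
    rw [this, map_zero]
    exact le_rfl
  | succ N ih =>
    have h0 := (s I).2.1
    have h1 := sub_nonneg.2 (s I).2.2
    have hδ := G.δ_pos
    have hδ' := G.δ_lt_one
    have hv := G.loneValue_nonneg N (mass L true) (mass L false)
    calc _ ≤ _ := G.truncPay_succ_le_of_silent ih H
      _ ≤ s I * G.loneValue (N + 1) (mass L true) (mass L false) +
          (1 - s I) * G.loneValue (N + 1) (mass L true) (mass L false) := by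
          gcongr
          · rw [loneValue]
            gcongr
            exact le_max_right _ _
          -- Safe play leaves the weights unchanged and merely delays the same problem.
          · refine le_trans ?_ (G.loneValue_le_succ N _ _)
            exact mul_le_of_le_one_left hv hδ'.le
      _ = _ := by ring

/-! ### Payoffs of the cascade profile -/

/-- Off the quiet path agent `i` plays risky forever, whatever she sees next. -/
theorem contPayoff_of_view_ne {h : Hist n} (H : view i h ≠ quietInfo n K h.length) :
    G.contPayoff (cascadeProfile n K) i (true, h) = G.E₁ := by
  refine G.contPayoff_of_expPay_const fun k => ?_
  induction k generalizing h with
  | zero =>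
    simp only [expPay]
    rw [sum_stepProb_pay, cascadeProfile_of_ne H]
    simp [mean]
  | succ k ih =>
    simp only [expPay]
    rw [Finset.sum_congr rfl fun o _ => by rw [ih (view_cons_ne H o)], ← Finset.sum_mul,
      sum_stepProb, one_mul]

theorem contPayoff_of_quiet {θ : Bool} {h : Hist n} (hK : K ≤ h.length)
    (H : ∀ j, view j h = quietInfo n K h.length) :
    G.contPayoff (cascadeProfile n K) i (θ, h) = 0 := by
  refine G.contPayoff_of_expPay_const fun k => ?_
  induction k generalizing h with
  | zero =>
    simp only [expPay]
    rw [sum_stepProb_pay, cascadeProfile_of_eq hK (H i)]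
    simp
  | succ k ih =>
    simp only [expPay]
    have hq : quietOutcome K h.length = .safe := by
      simp only [quietOutcome, if_neg (not_lt.2 hK)]
    rw [G.sum_stepProb_congr (g := fun _ => 0)]
    · simp
    · intro o ho
      have hs : ∀ j, o j = .safe := fun j => G.eq_safe ho (cascadeProfile_of_eq hK (H j))
      refine ih (by simp; omega) fun j => view_cons_eq_quietInfo.2 ⟨⟨fun k => ?_, ?_⟩, H j⟩
      · rw [hq, hs k]
      · rw [hq, hs j]

/-- An agent who plays safe while someone else goes on gets the good news next period. -/
theorem contPayoff_of_news {h : Hist n} (hK : K ≤ h.length)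
    (H : view i h = quietInfo n K h.length) {j : Fin n} (hj : view j h ≠ quietInfo n K h.length) :
    G.contPayoff (cascadeProfile n K) i (true, h) = G.δ * G.E₁ := by
  rw [contPayoff_eq]
  have hq : quietOutcome K h.length = .safe := by
    simp only [quietOutcome, if_neg (not_lt.2 hK)]
  rw [G.sum_stepProb_congr (g := fun _ => G.δ * G.E₁), ← Finset.sum_mul, sum_stepProb, one_mul]
  intro o ho
  have hi : o i = .safe := G.eq_safe ho (cascadeProfile_of_eq hK H)
  have hjr : (o j).act = .risky := G.act_eq_risky ho (cascadeProfile_of_ne hj)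
  rw [hi, G.contPayoff_of_view_ne (K := K)]
  · simp [pay]
  · intro e
    have := (view_cons_eq_quietInfo.1 e).1.1 j
    rw [hjr, hq] at this
    cases this

/-- The nodes that agent `i` deems possible on the quiet path after `m` periods. -/
def QuietNode (K : ℕ) (i : Fin n) (m : ℕ) (x : Node n) : Prop :=
  x.2.length = m ∧ view i x.2 = quietInfo n K m ∧
    (x.1 = false → ∀ j, view j x.2 = quietInfo n K m)

/-- Once the agent stops, either everybody stops for good, or the state is good and she resumes on
the news. -/
theorem QuietNode.contPayoff_nonneg {m : ℕ} (hm : K ≤ m) {x : Node n} (hx : QuietNode K i m x) :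
    0 ≤ G.contPayoff (cascadeProfile n K) i x := by
  obtain ⟨θ, h⟩ := x
  obtain ⟨rfl, h2, h3⟩ := hx
  by_cases H : ∀ j, view j h = quietInfo n K h.length
  · rw [G.contPayoff_of_quiet hm H]
  · cases θ with
    | false => exact absurd (h3 rfl) H
    | true =>
      push Not at H
      obtain ⟨j, hj⟩ := H
      rw [G.contPayoff_of_news hm h2 hj]
      exact mul_nonneg G.δ_pos.le G.E₁_pos.le

/-! ### Incentives from the cutoff on. -/

open Classical in
/-- The restriction of functions on nodes to a set of nodes. -/
noncomputable def restrict (Q : Node n → Prop) : (Node n → ℝ) →ₗ[ℝ] (Node n → ℝ) where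
  toFun f x := if Q x then f x else 0
  map_add' f g := by ext x; by_cases h : Q x <;> simp [h]
  map_smul' c f := by ext x; by_cases h : Q x <;> simp [h]

theorem restrict_add_restrict (Q : Node n → Prop) (L : (Node n → ℝ) →ₗ[ℝ] ℝ) (f : Node n → ℝ) :
    (L ∘ₗ restrict Q) f + (L ∘ₗ restrict fun x => ¬ Q x) f = L f := by
  rw [LinearMap.comp_apply, LinearMap.comp_apply, ← map_add]
  congr 1
  ext x
  by_cases h : Q x <;> simp [restrict, h]

theorem Carried.restrict {P : Node n → Prop} (H : Carried P L) (Q : Node n → Prop) :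
    Carried (fun x => P x ∧ Q x) (L ∘ₗ Game.restrict Q) := by
  intro f hf
  refine H _ fun x hx => ?_
  simp only [Game.restrict, LinearMap.coe_mk, AddHom.coe_mk]
  split_ifs with h
  · exact hf x ⟨hx, h⟩
  · exact le_rfl

/-- At and after the cutoff, no deviation on the quiet path is profitable. -/
theorem truncPay_le_of_ge {m : ℕ} (hm : K ≤ m) (H : Carried (QuietNode K i m) L)
    (hs : G.slack (mass L true) (mass L false) ≤ 0) (s : Strategy n) (N : ℕ) :
    L (G.truncPay (Function.update (cascadeProfile n K) i s) i N) ≤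
      L (G.contPayoff (cascadeProfile n K) i) := by
  cases N with
  | zero =>
    have : G.truncPay (Function.update (cascadeProfile n K) i s) i 0 = 0 := rfl
    rw [this, map_zero]
    exact H _ fun x hx => hx.contPayoff_nonneg G hm
  | succ N =>
    have hE := G.E₁_pos
    have hδ := G.δ_pos
    have hδ' := G.δ_lt_one
    have hπ := G.π_pos
    have hπ' := G.π_lt_one
    have h0 := (s (quietInfo n K m)).2.1
    set ρ : ℝ := (s (quietInfo n K m)).1
    let Q : Node n → Prop := fun x => ∀ j, view j x.2 = quietInfo n K m
    have HQ := H.restrict Q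
    have HQ' := H.restrict fun x => ¬ Q x
    set LQ := L ∘ₗ restrict Q
    set LQ' := L ∘ₗ restrict fun x => ¬ Q x
    have hadd := restrict_add_restrict Q L
    have m1 : mass LQ true + mass LQ' true = mass L true := hadd _
    have m0 : mass LQ false + mass LQ' false = mass L false := hadd _
    -- In the bad state nobody can have drawn high, so the whole bad weight lies on nodes that are
    -- quiet for everyone.
    have m0' : mass LQ' false = 0 := by
      have := HQ'.congr (f := fun x => if x.1 = false then 1 else 0) (g := 0) fun x hx => by
        by_cases e : x.1 = false
        · exact absurd (hx.1.2.2 e) hx.2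
        · simp [e]
      rw [map_zero] at this
      exact this
    have p1 := HQ.mass_nonneg true
    have p1' := HQ'.mass_nonneg true
    rw [m0', add_zero] at m0
    have hsQ : G.slack (mass LQ true) (mass LQ false) ≤ 0 := by
      rw [m0]
      exact (G.slack_mono (by linarith) _).trans hs
    have hsQ' : G.slack ((1 - G.π) * mass LQ true) (mass LQ false) ≤ 0 :=
      (G.slack_mono (by nlinarith) _).trans hsQ
    have HS : Carried (fun x => view i x.2 = quietInfo n K m ∧ Silent K i false x.2) LQ :=
      HQ.mono fun x hx => ⟨hx.1.2.1, fun j _ => by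
        simp only [Bool.false_eq_true, if_false, hx.1.1]
        exact ⟨hm, hx.2 j⟩⟩
    have bQ := G.truncPay_succ_le_of_silent (N := N) (s := s)
      (fun L b I => G.truncPay_le_of_silent N s L b I) HS
    rw [G.loneValue_eq_zero N p1 hsQ, G.loneValue_eq_zero N (by nlinarith) hsQ'] at bQ
    have bQ' : LQ' (G.truncPay (Function.update (cascadeProfile n K) i s) i (N + 1)) ≤
        ((1 - G.δ) * (ρ * G.E₁) + G.δ * G.E₁) * mass LQ' true := by
      have h1 := HQ'.le (f := G.truncPay (Function.update (cascadeProfile n K) i s) i (N + 1))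
        (g := fun x => (fun _ => (1 - G.δ) * (ρ * G.E₁) + G.δ * G.E₁) x.1) fun ⟨θ, h⟩ hx => by
          cases θ with
          | false => exact absurd (hx.1.2.2 rfl) hx.2
          | true =>
            have := G.truncPay_true_succ_le (Function.update (cascadeProfile n K) i s) i N h
            rw [Function.update_self, hx.1.2.1] at this
            exact this
      rw [apply_state LQ' fun _ => (1 - G.δ) * (ρ * G.E₁) + G.δ * G.E₁, m0'] at h1
      simpa using h1
    have uQ : LQ (G.contPayoff (cascadeProfile n K) i) = 0 := by
      rw [HQ.congr (g := 0) fun ⟨θ, h⟩ hx => ?_, map_zero]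
      obtain ⟨⟨rfl, -⟩, hq⟩ := hx
      exact G.contPayoff_of_quiet hm hq
    have uQ' : LQ' (G.contPayoff (cascadeProfile n K) i) = G.δ * G.E₁ * mass LQ' true := by
      rw [HQ'.congr (g := fun x => (fun _ => G.δ * G.E₁) x.1) fun ⟨θ, h⟩ hx => ?_]
      · rw [apply_state LQ' fun _ => G.δ * G.E₁, m0']
        simp
      · obtain ⟨⟨rfl, h2, h3⟩, hq⟩ := hx
        cases θ with
        | false => exact absurd (h3 rfl) hq
        | true =>
          have hq' : ∃ j, view j h ≠ quietInfo n K h.length := by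
            by_contra hc
            push Not at hc
            exact hq hc
          obtain ⟨j, hj⟩ := hq'
          exact G.contPayoff_of_news hm h2 hj
    rw [← hadd, ← hadd (G.contPayoff _ _), uQ, uQ']
    -- Slack is additive in the good weight. The slack of the whole weight exceeds this bracket by
    -- the nonnegative term `δ π E₁` times the good weight of `LQ'`.
    have key : ρ * (G.slack (mass LQ true) (mass LQ false) +
        (1 - G.δ) * G.E₁ * mass LQ' true) ≤ 0 := by
      refine mul_nonpos_of_nonneg_of_nonpos h0 (le_trans ?_ hs)
      rw [slack_eq, slack_eq, ← m1, m0]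
      have : 0 ≤ G.δ * (G.π * mass LQ' true * G.E₁) := by positivity
      linarith
    linarith

/-! ### Incentives before the cutoff. -/

theorem Carried.quiet_branch_low {m : ℕ} (hm : m < K) (H : Carried (QuietNode K i m) L) :
    Carried (QuietNode K i (m + 1)) (L ∘ₗ G.branch (cascadeProfile n K) i .low) := by
  refine Carried.branch G H fun ⟨θ, h⟩ hx o hi ho => ?_
  obtain ⟨rfl, h2, h3⟩ := hx
  have hq : quietOutcome K h.length = .low := if_pos hm
  have hr : ∀ j, (o j).act = .risky := by
    intro j
    refine G.act_eq_risky ho ?_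
    by_cases e : j = i
    · rw [e, Function.update_self]; rfl
    · rw [Function.update_of_ne e]; exact cascadeProfile_of_lt j hm
  refine ⟨rfl, view_cons_eq_quietInfo.2 ⟨⟨fun j => ?_, ?_⟩, h2⟩, fun hθ j =>
    view_cons_eq_quietInfo.2 ⟨⟨fun j => ?_, ?_⟩, h3 hθ j⟩⟩
  · rw [hr, hq]; rfl
  · rw [hi, hq]
  · rw [hr, hq]; rfl
  · obtain rfl : θ = false := hθ
    rw [hq]
    exact eq_low_of_act (hr j) (G.ne_high ho j)

/-- Before the cutoff, the cascade profile pays like playing risky once more. -/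
theorem apply_contPayoff_of_lt {m : ℕ} (hm : m < K) (H : Carried (QuietNode K i m) L) :
    L (G.contPayoff (cascadeProfile n K) i) = G.slack (mass L true) (mass L false) +
      G.δ * L (G.branch (cascadeProfile n K) i .low (G.contPayoff (cascadeProfile n K) i)) := by
  have e := H.apply_step G (s := cascadeProfile n K i) (σ := cascadeProfile n K)
    (fun x hx => hx.2.1) (G.contPayoff (cascadeProfile n K) i)
  have hσ : cascadeProfile n K i (quietInfo n K m) = 1 := by
    rw [← view_quietHist i]
    exact cascadeProfile_of_lt i (by simpa using hm)
  have hh : L (G.branch (cascadeProfile n K) i .high (G.contPayoff (cascadeProfile n K) i)) =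
      G.π * mass L true * G.E₁ := by
    have H' : Carried (fun x => x.1 = true ∧ view i x.2 ≠ quietInfo n K x.2.length)
        (L ∘ₗ G.branch (cascadeProfile n K) i .high) := by
      refine Carried.branch G H fun x hx o hi ho => ⟨?_, fun e => ?_⟩
      · by_contra e
        rw [Bool.not_eq_true] at e
        rw [e] at ho
        exact G.ne_high ho i hi
      · have := (view_cons_eq_quietInfo.1 e).1.2
        rw [hi] at this
        unfold quietOutcome at this
        split_ifs at this
    have h1 := H'.congr (f := G.contPayoff (cascadeProfile n K) i)
      (g := fun x => (fun θ => if θ = true then G.E₁ else 0) x.1) fun ⟨θ, h⟩ hx => by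
        obtain ⟨rfl, hx⟩ := hx
        simpa using G.contPayoff_of_view_ne hx
    rw [apply_state _ fun θ => if θ = true then G.E₁ else 0, mass_branch_high] at h1
    simp only [LinearMap.comp_apply] at h1
    rw [h1]
    simp
    ring
  rw [Function.update_eq_self, hσ, hh] at e
  simp only [← contPayoff_eq] at e
  rw [slack_eq]
  refine Eq.trans e ?_
  simp
  ring

theorem slack_pow_succ (j : ℕ) (w₁ w₀ : ℝ) :
    G.slack ((1 - G.π) ^ j * ((1 - G.π) * w₁)) w₀ = G.slack ((1 - G.π) ^ (j + 1) * w₁) w₀ := by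
  rw [pow_succ, mul_assoc]

/-- For the next `d` periods the profile experiments exactly as a lone agent would like to. At the
cutoff the lone value is zero, while the profile still has the nonnegative value of news about the
others' draws. -/
theorem loneValue_le_contPayoff (d : ℕ) {m : ℕ} (hm : m + d = K)
    (H : Carried (QuietNode K i m) L)
    (hs : G.slack ((1 - G.π) ^ d * mass L true) (mass L false) ≤ 0)
    (hs' : ∀ j < d, 0 ≤ G.slack ((1 - G.π) ^ j * mass L true) (mass L false)) (N : ℕ) :
    G.loneValue N (mass L true) (mass L false) ≤ L (G.contPayoff (cascadeProfile n K) i) := by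
  induction d generalizing m L N with
  | zero =>
    rw [G.loneValue_eq_zero N (H.mass_nonneg _) (by simpa using hs)]
    exact H _ fun x hx => hx.contPayoff_nonneg G (by omega)
  | succ d ih =>
    have hδ := G.δ_pos
    obtain ⟨e1, e0⟩ := G.mass_branch_low L (cascadeProfile n K) i
    have ih' := ih (m := m + 1) (by omega) (H.quiet_branch_low G (by omega))
      (by rwa [e1, e0, slack_pow_succ])
      (fun j hj => by rw [e1, e0, slack_pow_succ]; exact hs' _ (by omega))
    rw [e1, e0] at ih'
    have h0 : 0 ≤ G.slack (mass L true) (mass L false) := by simpa using hs' 0 (by omega)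
    rw [G.apply_contPayoff_of_lt (by omega) H]
    cases N with
    | zero => exact add_nonneg h0 (mul_nonneg hδ.le (ih' 0))
    | succ N =>
      rw [loneValue, max_eq_right h0]
      gcongr
      exact ih' N

/-- Before the cutoff, no deviation on the quiet path is profitable. -/
theorem truncPay_le_of_le (d : ℕ) {m : ℕ} (hm : m + d = K)
    (H : Carried (QuietNode K i m) L)
    (hs : G.slack ((1 - G.π) ^ d * mass L true) (mass L false) ≤ 0)
    (hs' : ∀ j < d, 0 ≤ G.slack ((1 - G.π) ^ j * mass L true) (mass L false))
    (s : Strategy n) (N : ℕ) :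
    L (G.truncPay (Function.update (cascadeProfile n K) i s) i N) ≤
      L (G.contPayoff (cascadeProfile n K) i) := by
  induction d generalizing m L N with
  | zero => exact G.truncPay_le_of_ge (by omega) H (by simpa using hs) s N
  | succ d ih =>
    have hlone := G.loneValue_le_contPayoff (d + 1) hm H hs hs'
    cases N with
    | zero =>
      have : G.truncPay (Function.update (cascadeProfile n K) i s) i 0 = 0 := rfl
      rw [this, map_zero]
      exact hlone 0
    | succ N =>
      have hδ := G.δ_pos
      have hδ' := G.δ_lt_one
      have h0 := (s (quietInfo n K m)).2.1
      have h1 := sub_nonneg.2 (s (quietInfo n K m)).2.2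
      obtain ⟨e1, e0⟩ := G.mass_branch_low L (cascadeProfile n K) i
      have hlow := ih (m := m + 1) (by omega) (H.quiet_branch_low G (by omega))
        (by rwa [e1, e0, slack_pow_succ])
        (fun j hj => by rw [e1, e0, slack_pow_succ]; exact hs' _ (by omega)) N
      -- Everyone else sees safe where a quiet record has risky, so the others play risky forever
      -- and become uninformative.
      have HS : Carried (fun x => view i x.2 =
          ((fun j => if j = i then .safe else .risky), .safe) :: quietInfo n K m ∧
            Silent K i true x.2) (L ∘ₗ G.branch (cascadeProfile n K) i .safe) := by
        refine Carried.branch G H fun ⟨θ, h⟩ hx o hi ho => ?_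
        obtain ⟨rfl, h2, h3⟩ := hx
        have hlt : h.length < K := by simp only at hm; omega
        refine ⟨?_, fun j hj => ?_⟩
        · rw [view_cons, h2, hi]
          congr 2
          ext j
          by_cases e : j = i
          · rw [if_pos e, e, hi]; rfl
          · rw [if_neg e]
            refine G.act_eq_risky ho ?_
            rw [Function.update_of_ne e]
            exact cascadeProfile_of_lt j hlt
        · rw [if_pos rfl]
          intro e
          have := (view_cons_eq_quietInfo.1 e).1.1 i
          rw [hi, quietOutcome, if_pos hlt] at this
          cases this
      have hsafe := G.truncPay_le_of_silent N s _ _ _ HS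
      rw [mass_branch_safe, mass_branch_safe] at hsafe
      have hsafe' := hsafe.trans (hlone N)
      have hnn := (G.loneValue_nonneg _ _ _).trans (hlone N)
      have hhigh := H.branch_high_le G (cascadeProfile n K) i
        (G.truncPay_true_le (Function.update (cascadeProfile n K) i s) i N)
      have e := H.apply_step G (s := s) (σ := cascadeProfile n K) (fun x hx => hx.2.1)
        (G.truncPay (Function.update (cascadeProfile n K) i s) i N)
      have hU := G.apply_contPayoff_of_lt (by omega) H
      rw [slack_eq] at hU
      simp only [LinearMap.comp_apply] at hlow hsafe'
      refine (le_of_eq e).trans ?_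
      set U := L (G.contPayoff (cascadeProfile n K) i)
      calc _ ≤ (s (quietInfo n K m)).1 * U + (1 - (s (quietInfo n K m)).1) * U := by
            gcongr
            · rw [hU]
              have := mul_le_mul_of_nonneg_left hlow hδ.le
              have := mul_le_mul_of_nonneg_left hhigh hδ.le
              linarith
            · exact (mul_le_mul_of_nonneg_left hsafe' hδ.le).trans
                (mul_le_of_le_one_left hnn hδ'.le)
        _ = U := by ring

/-! ### Weights of the quiet path -/

/-- Without high draws the profile is deterministic. -/
theorem eq_quietHist {h : Hist n} (H : 0 < G.histProb (cascadeProfile n K) false h) :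
    h = quietHist n K h.length := by
  induction h with
  | nil => rfl
  | cons o h ih =>
    obtain ⟨h1, h2⟩ := G.pos_of_histProb_cons H
    have e := ih h1
    have hv : ∀ j, view j h = quietInfo n K h.length := fun j => by
      rw [e, view_quietHist, length_quietHist]
    rw [List.length_cons, quietHist, ← e]
    congr 1
    ext j
    by_cases hK : h.length < K
    · rw [quietOutcome, if_pos hK]
      exact eq_low_of_act (G.act_eq_risky h2 (cascadeProfile_of_lt j hK)) (G.ne_high h2 j)
    · rw [quietOutcome, if_neg hK]
      exact G.eq_safe h2 (cascadeProfile_of_eq (not_lt.1 hK) (hv j))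

theorem histProb_quietHist (m : ℕ) :
    G.histProb (cascadeProfile n K) false (quietHist n K m) = 1 := by
  induction m with
  | zero => rfl
  | succ m ih =>
    rw [quietHist, histProb, ih, one_mul]
    refine Finset.prod_eq_one fun j _ => ?_
    have hl := length_quietHist (n := n) (K := K) m
    by_cases hK : m < K
    · rw [cascadeProfile_of_lt j (by omega), quietOutcome, if_pos hK]
      simp [outcomeProb, winProb]
    · rw [cascadeProfile_of_eq (by omega) (by rw [hl, view_quietHist]), quietOutcome, if_neg hK]
      simp [outcomeProb]

open Classical in
/-- The probability of what agent `i` sees on the quiet path, in the good state. -/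
noncomputable def quietProb (K : ℕ) (i : Fin n) (m : ℕ) : ℝ :=
  ∑ h ∈ histories n m,
    if view i h = quietInfo n K m then G.histProb (cascadeProfile n K) true h else 0

theorem sum_histories_succ (m : ℕ) (f : Hist n → ℝ) :
    ∑ h ∈ histories n (m + 1), f h = ∑ h ∈ histories n m, ∑ o, f (o :: h) := by
  rw [histories, Finset.sum_image, Finset.sum_product_right]
  rintro ⟨a, b⟩ - ⟨c, d⟩ - e
  simpa using e

open Classical in
theorem quietProb_succ (i : Fin n) (m : ℕ) :
    G.quietProb K i (m + 1) = ∑ h ∈ histories n m,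
      if view i h = quietInfo n K m then G.histProb (cascadeProfile n K) true h *
        ∑ o, G.stepProb (cascadeProfile n K) true h o *
          (if (∀ j, (o j).act = (quietOutcome K m).act) ∧ o i = quietOutcome K m then 1 else 0)
      else 0 := by
  rw [quietProb, sum_histories_succ]
  refine Finset.sum_congr rfl fun h _ => ?_
  simp only [view_cons_eq_quietInfo]
  split_ifs with hv
  · rw [Finset.mul_sum]
    refine Finset.sum_congr rfl fun o _ => ?_
    by_cases ho : (∀ j, (o j).act = (quietOutcome K m).act) ∧ o i = quietOutcome K m
    · rw [if_pos ⟨ho, hv⟩, if_pos ho, mul_one, histProb]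
    · rw [if_neg (fun h => ho h.1), if_neg ho, mul_zero, mul_zero]
  · simp [hv]

theorem quietProb_succ_le (i : Fin n) (m : ℕ) :
    G.quietProb K i (m + 1) ≤ G.quietProb K i m := by
  classical
  rw [quietProb_succ, quietProb]
  refine Finset.sum_le_sum fun h _ => ?_
  split_ifs with hv
  · refine mul_le_of_le_one_right (G.histProb_nonneg _ _ _) ?_
    calc _ ≤ ∑ o, G.stepProb (cascadeProfile n K) true h o * 1 :=
          G.sum_stepProb_le fun o _ => by split_ifs <;> norm_num
      _ = 1 := by simp [sum_stepProb]
  · exact le_rfl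

/-- Before the cutoff all actions are risky regardless of draws, so only her own draw matters for
what agent `i` sees. -/
theorem quietProb_succ_of_lt (i : Fin n) {m : ℕ} (hm : m < K) :
    G.quietProb K i (m + 1) = (1 - G.π) * G.quietProb K i m := by
  classical
  rw [quietProb_succ, quietProb, Finset.mul_sum]
  refine Finset.sum_congr rfl fun h hh => ?_
  have hl := (mem_histories m h).1 hh
  split_ifs with hv
  · rw [G.sum_stepProb_congr (g := fun o => (fun y => if y = .low then 1 else 0) (o i)),
      G.sum_stepProb_own _ i true h fun y => if y = .low then 1 else 0, sum_outcome,
      cascadeProfile_of_lt i (by omega)]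
    · simp [outcomeProb, winProb]
      ring
    · intro o ho
      have hr : ∀ j, (o j).act = .risky := fun j =>
        G.act_eq_risky ho (cascadeProfile_of_lt j (by omega))
      rw [quietOutcome, if_pos hm]
      have hl : ∀ j, (o j).act = Outcome.low.act := hr
      simp [hl]
  · simp

theorem quietProb_of_le (i : Fin n) {m : ℕ} (hm : m ≤ K) :
    G.quietProb K i m = (1 - G.π) ^ m := by
  induction m with
  | zero => simp [quietProb, histories, histProb, view, quietInfo]
  | succ m ih =>
    rw [G.quietProb_succ_of_lt i (by omega), ih (by omega), pow_succ, mul_comm]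

theorem quietProb_le (i : Fin n) {m : ℕ} (hm : K ≤ m) :
    G.quietProb K i m ≤ (1 - G.π) ^ K := by
  induction m, hm using Nat.le_induction with
  | base => exact (G.quietProb_of_le i le_rfl).le
  | succ m _ ih => exact (G.quietProb_succ_le i m).trans ih

theorem nodeProb_nonneg (σ : Profile n) (i : Fin n) (x : Node n) : 0 ≤ G.nodeProb σ i x := by
  have := G.q_pos i
  have := G.q_lt_one i
  refine mul_nonneg ?_ (G.histProb_nonneg _ _ _)
  unfold prior
  split_ifs <;> linarith

/-- The weight that the prior puts on the nodes of an information set. -/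
noncomputable def infoWeight (σ : Profile n) (i : Fin n) (I : Info n) :
    (Node n → ℝ) →ₗ[ℝ] ℝ where
  toFun f := ∑ x ∈ infoSet i I, G.nodeProb σ i x * f x
  map_add' f g := by simp [mul_add, Finset.sum_add_distrib]
  map_smul' c f := by
    simp only [Pi.smul_apply, smul_eq_mul, Finset.mul_sum, RingHom.id_apply]
    exact Finset.sum_congr rfl fun x _ => by ring

theorem infoWeight_apply (σ : Profile n) (i : Fin n) (I : Info n) (f : Node n → ℝ) :
    G.infoWeight σ i I f = ∑ x ∈ infoSet i I, G.nodeProb σ i x * f x := rfl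

theorem histProb_pos_of_nodeProb {σ : Profile n} {i : Fin n} {x : Node n}
    (H : 0 < G.nodeProb σ i x) : 0 < G.histProb σ x.1 x.2 := by
  refine lt_of_le_of_ne (G.histProb_nonneg _ _ _) fun e => ?_
  rw [nodeProb, ← e, mul_zero] at H
  exact H.false

/-- A node of the bad state with positive probability has history `quietHist`, hence is quiet for
every agent. -/
theorem carried_infoWeight (i : Fin n) (m : ℕ) :
    Carried (QuietNode K i m) (G.infoWeight (cascadeProfile n K) i (quietInfo n K m)) := by
  intro f hf
  refine Finset.sum_nonneg fun x hx => ?_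
  have hx := (mem_infoSet i _ x).1 hx
  rcases (G.nodeProb_nonneg (cascadeProfile n K) i x).eq_or_lt with e | e
  · rw [← e, zero_mul]
  · have hl : x.2.length = m := by
      have := congrArg List.length hx.2
      simpa using this
    refine mul_nonneg e.le (hf x ⟨hl, hx.2, fun hθ j => ?_⟩)
    have hp := G.histProb_pos_of_nodeProb e
    rw [hθ] at hp
    rw [G.eq_quietHist hp, view_quietHist, hl]

theorem mass_infoWeight_eq (i : Fin n) (I : Info n) (σ : Profile n) (θ : Bool) :
    mass (G.infoWeight σ i I) θ =
      ∑ h ∈ histories n I.length, open Classical in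
        if Feasible (θ, h) ∧ view i h = I then G.nodeProb σ i (θ, h) else 0 := by
  classical
  rw [mass, infoWeight_apply, infoSet, Finset.sum_filter, Finset.sum_product]
  cases θ <;> simp [Fintype.univ_bool]

theorem mass_infoWeight_true (i : Fin n) (m : ℕ) :
    mass (G.infoWeight (cascadeProfile n K) i (quietInfo n K m)) true =
      G.q i * G.quietProb K i m := by
  rw [mass_infoWeight_eq, quietProb, Finset.mul_sum, length_quietInfo]
  refine Finset.sum_congr rfl fun h _ => ?_
  simp [Feasible, nodeProb, prior]

theorem feasible_quietHist (θ : Bool) (m : ℕ) : Feasible (θ, quietHist n K m) := by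
  suffices ∀ o ∈ quietHist n K m, ∀ j, o j ≠ .high from fun _ => this
  induction m with
  | zero => simp [quietHist]
  | succ m ih =>
    simp only [quietHist, List.mem_cons, forall_eq_or_imp]
    refine ⟨fun _ => ?_, ih⟩
    unfold quietOutcome
    split_ifs <;> simp

theorem mass_infoWeight_false (i : Fin n) (m : ℕ) :
    mass (G.infoWeight (cascadeProfile n K) i (quietInfo n K m)) false = 1 - G.q i := by
  rw [mass_infoWeight_eq, length_quietInfo, Finset.sum_eq_single (quietHist n K m)]
  · rw [if_pos ⟨feasible_quietHist _ m, view_quietHist i m⟩, nodeProb, histProb_quietHist]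
    simp [prior]
  · intro h hh hne
    split_ifs with hv
    · have hz : G.histProb (cascadeProfile n K) false h = 0 := by
        by_contra e
        have := G.eq_quietHist (lt_of_le_of_ne (G.histProb_nonneg _ _ _) (Ne.symm e))
        rw [(mem_histories m h).1 hh] at this
        exact hne this
      rw [nodeProb, hz, mul_zero]
    · rfl
  · intro hh
    exact absurd ((mem_histories m _).2 (length_quietHist m)) hh

theorem reachProb_quietInfo_pos (i : Fin n) (m : ℕ) :
    0 < G.reachProb (cascadeProfile n K) i (quietInfo n K m) := by
  refine Finset.sum_pos' (fun x _ => G.nodeProb_nonneg _ _ x)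
    ⟨(false, quietHist n K m), (mem_infoSet _ _ _).2
      ⟨feasible_quietHist _ m, view_quietHist i m⟩, ?_⟩
  have := G.q_lt_one i
  rw [nodeProb, histProb_quietHist]
  simp [prior]
  linarith

/-- On the quiet path no deviation is profitable if `K` is the cutoff of a lone agent. -/
theorem infoWeight_contPayoff_le (i : Fin n)
    (hK : G.slack ((1 - G.π) ^ K * G.q i) (1 - G.q i) ≤ 0)
    (hK' : ∀ j < K, 0 ≤ G.slack ((1 - G.π) ^ j * G.q i) (1 - G.q i)) (m : ℕ) (s : Strategy n) :
    G.infoWeight (cascadeProfile n K) i (quietInfo n K m)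
        (G.contPayoff (Function.update (cascadeProfile n K) i s) i) ≤
      G.infoWeight (cascadeProfile n K) i (quietInfo n K m)
        (G.contPayoff (cascadeProfile n K) i) := by
  have H := G.carried_infoWeight (K := K) i m
  have hlim : Filter.Tendsto (fun N => G.infoWeight (cascadeProfile n K) i (quietInfo n K m)
      (G.truncPay (Function.update (cascadeProfile n K) i s) i N)) Filter.atTop
      (nhds (G.infoWeight (cascadeProfile n K) i (quietInfo n K m)
        (G.contPayoff (Function.update (cascadeProfile n K) i s) i))) := by
    simp only [infoWeight_apply]
    exact tendsto_finsetSum _ fun x _ => (G.tendsto_truncPay _ i x).const_mul _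
  refine le_of_tendsto' hlim fun N => ?_
  have m1 := G.mass_infoWeight_true (K := K) i m
  have m0 := G.mass_infoWeight_false (K := K) i m
  rcases le_total m K with hm | hm
  · rw [G.quietProb_of_le i hm] at m1
    have e : ∀ j, G.slack ((1 - G.π) ^ j *
        mass (G.infoWeight (cascadeProfile n K) i (quietInfo n K m)) true)
        (mass (G.infoWeight (cascadeProfile n K) i (quietInfo n K m)) false) =
        G.slack ((1 - G.π) ^ (j + m) * G.q i) (1 - G.q i) := fun j => by
      rw [m1, m0]
      congr 1
      rw [pow_add]
      ring
    refine G.truncPay_le_of_le (K - m) (by omega) H ?_ (fun j hj => ?_) s N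
    · rwa [e, Nat.sub_add_cancel hm]
    · rw [e]
      exact hK' _ (by omega)
  · refine G.truncPay_le_of_ge hm H ?_ s N
    rw [m1, m0]
    -- After the cutoff, seeing the others stop can only lower the good weight further, while the
    -- bad weight stays at `1 - q`.
    refine (G.slack_mono ?_ _).trans hK
    rw [mul_comm]
    exact mul_le_mul_of_nonneg_right (G.quietProb_le i hm) (G.q_pos i).le

/-! ### The equilibrium -/

open Classical in
/-- Beliefs by Bayes' rule on the path; off the path, certainty of the good state. -/
noncomputable def optimisticBeliefs (σ : Profile n) : Beliefs n := fun i I x =>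
  if 0 < G.reachProb σ i I then G.nodeProb σ i x / G.reachProb σ i I
  else if h : (infoSet i I).Nonempty then (if x = (true, h.choose.2) then 1 else 0) else 0

theorem true_mem_infoSet {i : Fin n} {I : Info n} {x : Node n} (hx : x ∈ infoSet i I) :
    (true, x.2) ∈ infoSet i I :=
  (mem_infoSet _ _ _).2 ⟨fun h => (Bool.noConfusion h), ((mem_infoSet _ _ _).1 hx).2⟩

theorem isBeliefSystem_optimisticBeliefs (σ : Profile n) :
    IsBeliefSystem (G.optimisticBeliefs σ) := by
  intro i I hne
  simp only [optimisticBeliefs]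
  by_cases hr : 0 < G.reachProb σ i I
  · simp only [if_pos hr]
    refine ⟨fun x _ => div_nonneg (G.nodeProb_nonneg _ _ _) hr.le, ?_⟩
    rw [← Finset.sum_div]
    exact div_self hr.ne'
  · simp only [if_neg hr, dif_pos hne]
    refine ⟨fun x _ => by split_ifs <;> norm_num, ?_⟩
    rw [Finset.sum_ite_eq', if_pos (true_mem_infoSet hne.choose_spec)]

theorem bayesConsistent_optimisticBeliefs (σ : Profile n) :
    G.BayesConsistent σ (G.optimisticBeliefs σ) := by
  intro i I hr x _
  simp only [optimisticBeliefs, if_pos hr]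

/-- If the set is reached, every bad-state node in it has probability zero, because bad-state play
stays quiet; otherwise the belief is a point mass on a good-state node. -/
theorem optimisticBeliefs_eq_zero {i : Fin n} {I : Info n} (hI : I ≠ quietInfo n K I.length)
    {h : Hist n} (hx : (false, h) ∈ infoSet i I) :
    G.optimisticBeliefs (cascadeProfile n K) i I (false, h) = 0 := by
  simp only [optimisticBeliefs]
  split_ifs with hr hne e
  · have : G.nodeProb (cascadeProfile n K) i (false, h) = 0 := by
      by_contra e
      have hp := G.histProb_pos_of_nodeProb
        (lt_of_le_of_ne (G.nodeProb_nonneg _ _ _) (Ne.symm e))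
      have hv := ((mem_infoSet _ _ _).1 hx).2
      rw [G.eq_quietHist hp, view_quietHist] at hv
      apply hI
      rw [← hv, length_quietInfo]
    rw [this, zero_div]
  · cases e
  · rfl
  · rfl

theorem sequentiallyRational_cascadeProfile
    (hK : ∀ i, G.slack ((1 - G.π) ^ K * G.q i) (1 - G.q i) ≤ 0)
    (hK' : ∀ i, ∀ j < K, 0 ≤ G.slack ((1 - G.π) ^ j * G.q i) (1 - G.q i)) :
    G.SequentiallyRational (cascadeProfile n K) (G.optimisticBeliefs (cascadeProfile n K)) := by
  intro i I hne s
  by_cases hI : I = quietInfo n K I.length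
  · have hr : 0 < G.reachProb (cascadeProfile n K) i I := by
      rw [hI]; exact G.reachProb_quietInfo_pos i _
    have e : ∀ σ, G.infoPayoff σ (G.optimisticBeliefs (cascadeProfile n K)) i I =
        G.infoWeight (cascadeProfile n K) i I (G.contPayoff σ i) /
          G.reachProb (cascadeProfile n K) i I := fun σ => by
      rw [infoPayoff, infoWeight_apply, Finset.sum_div]
      refine Finset.sum_congr rfl fun x _ => ?_
      simp only [optimisticBeliefs, if_pos hr]
      ring
    rw [e, e]
    have := G.infoWeight_contPayoff_le i (hK i) (hK' i) I.length s
    rw [← hI] at this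
    exact div_le_div_of_nonneg_right this hr.le
  -- Off the quiet path the comparison holds node by node: bad nodes have no weight, and at good
  -- nodes the profile attains the maximum `E₁`.
  · refine Finset.sum_le_sum fun ⟨θ, h⟩ hx => ?_
    cases θ with
    | false => rw [G.optimisticBeliefs_eq_zero hI hx, zero_mul, zero_mul]
    | true =>
      refine mul_le_mul_of_nonneg_left ?_
        ((G.isBeliefSystem_optimisticBeliefs _ i I hne).1 _ hx)
      have hv := ((mem_infoSet _ _ _).1 hx).2
      rw [G.contPayoff_of_view_ne (K := K)]
      · exact G.contPayoff_true_le _ _ _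
      · intro e
        apply hI
        have hv' : view i h = I := hv
        rw [← hv', e, length_quietInfo]

/-! ### The cascade outcome on the path of play. -/

theorem MissedCutoff.cons {τ : Fin n → ℕ} {h : Hist n} (H : MissedCutoff τ h)
    (o : Fin n → Outcome) : MissedCutoff τ (o :: h) := by
  obtain ⟨j, o', h', h1, h2⟩ := H
  exact ⟨j, o', h', h1.trans (List.suffix_cons _ _), h2⟩

/-- All actions up to period `K` are risky anyway, so only a high draw of her own could spoil the
record. -/
theorem view_eq_of_lt {h : Hist n} (hp : G.OnPath (cascadeProfile n K) h) (hl : h.length ≤ K)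
    (hO : OnlyLow i h) : view i h = quietInfo n K h.length := by
  obtain ⟨θ, hp⟩ := hp
  induction h with
  | nil => rfl
  | cons o h ih =>
    obtain ⟨h1, h2⟩ := G.pos_of_histProb_cons hp
    simp only [List.length_cons] at hl
    have hr : ∀ j, (o j).act = .risky := fun j =>
      G.act_eq_risky h2 (cascadeProfile_of_lt j (by omega))
    refine view_cons_eq_quietInfo.2 ⟨⟨fun j => ?_, ?_⟩,
      ih (by omega) (fun o ho => hO o (List.mem_cons_of_mem _ ho)) h1⟩
    · rw [hr, quietOutcome, if_pos (by omega)]; rfl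
    · rw [quietOutcome, if_pos (by omega)]
      exact hO o List.mem_cons_self (hr i)

theorem view_eq_of_not_missedCutoff {h : Hist n} (hp : G.OnPath (cascadeProfile n K) h)
    (hl : K < h.length) (hM : ¬ MissedCutoff (fun _ => K + 1) h) (i : Fin n) :
    view i h = quietInfo n K h.length := by
  obtain ⟨θ, hp⟩ := hp
  induction h generalizing i with
  | nil => simp at hl
  | cons o h ih =>
    obtain ⟨h1, h2⟩ := G.pos_of_histProb_cons hp
    simp only [List.length_cons] at hl
    have hq : quietOutcome K h.length = .safe := by
      simp only [quietOutcome, if_neg (show ¬ h.length < K by omega)]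
    have hv : (∀ j, o j = .safe) ∧ view i h = quietInfo n K h.length := by
      rcases (show K ≤ h.length by omega).eq_or_lt with e | e
      · have hs : ∀ j, o j = .safe := fun j => by
          refine eq_safe_of_act ?_
          cases ha : (o j).act with
          | safe => rfl
          | risky => exact absurd ⟨j, o, h, List.suffix_rfl, by simp [e], ha⟩ hM
        refine ⟨hs, ?_⟩
        -- An agent with a spoiled record would have played risky for sure at the cutoff,
        -- contradicting that all played safe.
        by_contra hne
        have := G.act_eq_risky h2 (cascadeProfile_of_ne hne)
        rw [hs] at this
        cases this
      · have hv := fun j => ih e (fun H => hM (H.cons o)) j h1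
        exact ⟨fun j => G.eq_safe h2 (cascadeProfile_of_eq e.le (hv j)), hv i⟩
    refine view_cons_eq_quietInfo.2 ⟨⟨fun j => ?_, ?_⟩, hv.2⟩
    · rw [hv.1, hq]
    · rw [hv.1, hq]

/-- The missed cutoff is a public risky action in a period where every quiet record shows safe. -/
theorem view_ne_of_missedCutoff {h : Hist n} (hM : MissedCutoff (fun _ => K + 1) h)
    (i : Fin n) : view i h ≠ quietInfo n K h.length := by
  obtain ⟨j, o, h', ⟨l, rfl⟩, hl, hr⟩ := hM
  induction l with
  | nil =>
    intro e
    have := (view_cons_eq_quietInfo.1 e).1.1 j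
    rw [hr, quietOutcome, if_neg (by simp only at hl; omega)] at this
    cases this
  | cons o' l ih => exact view_cons_ne ih o'

theorem inducesCascade_cascadeProfile :
    G.InducesCascade (cascadeProfile n K) fun _ => K + 1 := by
  refine ⟨fun _ => Nat.succ_pos K, fun h hp => ⟨fun hM i => ⟨fun hl => ?_, fun hl hO => ?_,
    fun hl hO => ?_, fun hl => ?_⟩, fun hM i => ?_⟩⟩ <;>
    try simp only at hl
  · exact cascadeProfile_of_lt i (by omega)
  · exact cascadeProfile_of_eq (by omega) (G.view_eq_of_lt hp (by omega) hO)
  · refine cascadeProfile_of_ne fun e => hO ?_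
    have hl' : h.length ≤ K := by omega
    clear hp hM hl hO
    induction h with
    | nil => intro o ho; simp at ho
    | cons o h ih =>
      simp only [List.length_cons] at hl'
      obtain ⟨⟨-, h2⟩, h3⟩ := view_cons_eq_quietInfo.1 e
      rw [quietOutcome, if_pos (by omega)] at h2
      intro o' ho' ha
      rcases List.mem_cons.1 ho' with rfl | ho'
      · exact h2
      · exact ih h3 (by omega) o' ho' ha
  · exact cascadeProfile_of_eq (by omega) (G.view_eq_of_not_missedCutoff hp (by omega) hM i)
  · exact cascadeProfile_of_ne (view_ne_of_missedCutoff hM i)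

/-- As low draws accumulate the good weight vanishes, and the slack tends to `-(1 - δ) (1 - q) E₀ <
0`. -/
theorem exists_slack_nonpos (q : ℝ) (hq : q < 1) :
    ∃ m : ℕ, G.slack ((1 - G.π) ^ m * q) (1 - q) ≤ 0 := by
  have hδ := G.δ_lt_one
  have hπ := G.π_pos
  have hπ' := G.π_lt_one
  have hE := G.E₀_pos
  have h1 : Filter.Tendsto (fun m : ℕ => G.slack ((1 - G.π) ^ m * q) (1 - q)) Filter.atTop
      (nhds (G.slack (0 * q) (1 - q))) := by
    have := tendsto_pow_atTop_nhds_zero_of_lt_one (r := 1 - G.π) (by linarith) (by linarith)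
    exact ((((this.mul_const q).mul_const _).mul_const _).sub_const _).const_mul _
  have h2 : G.slack (0 * q) (1 - q) < 0 := by
    have : 0 < (1 - G.δ) * ((1 - q) * G.E₀) :=
      mul_pos (by linarith) (mul_pos (by linarith) hE)
    rw [slack]
    linarith
  obtain ⟨m, hm⟩ := (h1.eventually (gt_mem_nhds h2)).exists
  exact ⟨m, hm.le⟩

/-- With a common prior, the cutoff of a lone agent supports a cascade equilibrium: whoever leaves
the path makes the others play risky forever and learns nothing more from them, so waiting before
the cutoff does not pay. -/
theorem exists_isCascadeEquilibrium (common : ∀ i j, G.q i = G.q j) :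
    ∃ σ : Profile n, G.IsCascadeEquilibrium σ := by
  classical
  obtain ⟨q, hq, hG⟩ : ∃ q : ℝ, q < 1 ∧ ∀ i, G.q i = q := by
    -- Without agents there is no prior to copy, and any number below 1 serves.
    rcases isEmpty_or_nonempty (Fin n) with h | ⟨⟨i⟩⟩
    · exact ⟨0, one_pos, fun i => h.elim i⟩
    · exact ⟨G.q i, G.q_lt_one i, fun j => common j i⟩
  have hex := G.exists_slack_nonpos q hq
  refine ⟨cascadeProfile n (Nat.find hex), ⟨_, G.isBeliefSystem_optimisticBeliefs _,
    G.bayesConsistent_optimisticBeliefs _, G.sequentiallyRational_cascadeProfile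
      (fun i => ?_) (fun i j hj => ?_)⟩, _, G.inducesCascade_cascadeProfile⟩
  · rw [hG]
    exact Nat.find_spec hex
  · rw [hG]
    exact (not_le.1 (Nat.find_min hex hj)).le

end Game
end Cascade

theorem proposition1 (n : ℕ) (G : Cascade.Game n)
    (common : ∀ i j, G.q i = G.q j)
    (hden : G.δ + G.π - (1 - G.π) * (1 + G.δ * G.π / (1 - G.δ)) ≠ 0)
    (hineq : G.E₁ / G.E₀ ≥
      (1 - G.π) / (G.δ + G.π - (1 - G.π) * (1 + G.δ * G.π / (1 - G.δ)))) :
    ∃ σ : Cascade.Profile n, G.IsCascadeEquilibrium σ := by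
  exact G.exists_isCascadeEquilibrium common
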